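/- **Theorem (Diffusion induced averages).** *The quasi-shuffle algebra.* Let $\Omega=\mathbb N^*=\{1,2,3,\dots\}$, let $\mathbf{Hqsh}$ be the real vector space spanned by the words with letters in $\Omega$, with the quasi-shuffle product, which is defined by $\emptyset\cdot w=w\cdot\emptyset=w$ and, for letters $a,b$ and words $m,n$, $$(am)\cdot(bn)=a\,(m\cdot bn)+b\,(am\cdot n)+(a+b)\,(m\cdot n),$$ and with the deconcatenation coproduct. A character is a linear form $\phi:\mathbf{Hqsh}\to\mathbb C$ with $\phi(\emptyset)=1$ and $\phi(x\cdot y)=\phi(x)\phi(y)$. For an algebra $B$, linear maps $F,G:\mathbf{Hqsh}\to B$ are multiplied by $(F*G)(\omega)=\sum_{\omega^1\omega^2=\omega}F(\omega^1)G(\omega^2)$; the unit $e$ sends $\emptyset$ to $1_B$ and every other word to $0$. Let $\iota(\omega)=1$ for words of length at most $1$ and $\iota(\omega)=0$ for longer words, and $\mathbf{rev}(\omega_1,\dots,\omega_r)=(\omega_r,\dots,\omega_1)$. A character $\phi$ *solves the algebraic problem of averages*, with companion $\psi$, if $\psi$ is a character, $\phi^{*-1}*\psi=\iota$ and $\psi^{*-1}=\overline{\phi}\circ\mathbf{rev}$.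 *The functions $f_\omega$.* Let $\beta:\mathbb R\to\mathbb R$ be real-analytic and even, and for $\omega\in\Omega$ put $f_\omega(x)=\frac1{2\pi}\int_{\mathbb R}e^{-\omega\beta(y)}e^{ixy}\,dy$. Assume that $\int_{\mathbb R}|f_\omega(x)|\,dx=1$ for every $\omega\in\Omega$. *The algebra.* Let $A$ be the algebra of bounded integrable functions $\mathbb R\to\mathbb C$ whose restrictions to $\mathbb R_+^*=(0,\infty)$ and to $\mathbb R_-^*=(-\infty,0)$ are continuous, with the convolution product $\star$ and a unit $\delta$ adjoined. Let $\sigma_+$ and $\sigma_-$ be the indicator functions of $(0,\infty)$ and of $(-\infty,0]$, and put $$R(c\delta+f)=f\sigma_+,\qquad \tilde R=\mathrm{id}-R,\qquad \Theta(c\delta+f)=c+\int_{\mathbb R}f(x)\,dx .$$ Let $\gamma=f_1$, which is an element of $A$. Let $a:\mathbf{Hqsh}\to A$ be the linear map with $a((\omega))=\gamma^{\star\omega}$ on words $(\omega)$ of length one and $a=0$ on all other words. For $P\in\{R,\tilde R\}$ let $(\mathcal Pa)^{[0]}=e$ and $(\mathcal Pa)^{[n+1]}=P\circ\big((\mathcal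 Pa)^{[n]}*a\big)$. *Statement.* Let $\phi_{\mathrm{diffusion}}$ be the linear form on $\mathbf{Hqsh}$ given on a word $\omega=(\omega_1,\dots,\omega_n)$ by $$\phi_{\mathrm{diffusion}}(\omega)=(-1)^n\int_{\mathbb R^n}f_{\omega_1}(x_1)\cdots f_{\omega_n}(x_n)\,\sigma_+(x_1)\,\sigma_+(x_1+x_2)\cdots\sigma_+(x_1+\cdots+x_n)\,dx_1\cdots dx_n .$$ The integrand is integrable, $\phi_{\mathrm{diffusion}}$ takes real values, and, for every word $\omega$ of length $n$, $$\phi_{\mathrm{diffusion}}(\omega)=(-1)^n\,\Theta\big((\mathcal Ra)^{[n]}(\omega)\big),$$ and, when $n\ge1$, $$\phi_{\mathrm{diffusion}}(\omega)=(-1)^n\int_{\mathbb R}\Big(\big(\cdots((f_1^{\star\omega_1}\sigma_+)\star f_1^{\star\omega_2})\sigma_+\star\cdots\big)\star f_1^{\star\omega_n}\Big)(x)\,\sigma_+(x)\,dx .$$ Moreover $\phi_{\mathrm{diffusion}}$ is a character that solves the algebraic problem of averages, and its companion $\psi$ satisfies, for every word $\omega$ of length $n$, $$\psi^{*-1}(\mathbf{rev}(\omega))=(-1)^n\,\Theta\big((\tilde{\mathcal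 R}a)^{[n]}(\omega)\big)=(-1)^n\int_{\mathbb R^n}f_{\omega_1}(x_1)\cdots f_{\omega_n}(x_n)\,\sigma_-(x_1)\,\sigma_-(x_1+x_2)\cdots\sigma_-(x_1+\cdots+x_n)\,dx_1\cdots dx_n ,$$ where the integrand is integrable, and, when $n\ge1$, $$\psi^{*-1}(\mathbf{rev}(\omega))=(-1)^n\int_{\mathbb R}\Big(\big(\cdots((f_1^{\star\omega_1}\sigma_-)\star f_1^{\star\omega_2})\sigma_-\star\cdots\big)\star f_1^{\star\omega_n}\Big)(x)\,\sigma_-(x)\,dx .$$ -/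

import Mathlib

open MeasureTheory Set
open scoped TensorProduct Convolution

noncomputable section

/-- The real vector space spanned by the words in the alphabet `Ω = ℕ* = {1, 2, 3, …}`. -/
def Hqsh : Type := List ℕ+ →₀ ℝ

namespace Hqsh

instance : AddCommGroup Hqsh := inferInstanceAs (AddCommGroup (List ℕ+ →₀ ℝ))

instance : Module ℝ Hqsh := inferInstanceAs (Module ℝ (List ℕ+ →₀ ℝ))

/-- The words form a basis of `Hqsh`. -/
def basis : Module.Basis (List ℕ+) ℝ Hqsh := ⟨LinearEquiv.refl ℝ (List ℕ+ →₀ ℝ)⟩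

/-- A word, as a basis vector of `Hqsh`. -/
def word (w : List ℕ+) : Hqsh := basis w

/-- The linear extension to `Hqsh` of a map given on words. -/
def extend {M : Type*} [AddCommGroup M] [Module ℝ M] (f : List ℕ+ → M) : Hqsh →ₗ[ℝ] M :=
  basis.constr ℝ f

@[simp] theorem extend_word {M : Type*} [AddCommGroup M] [Module ℝ M] (f : List ℕ+ → M)
    (w : List ℕ+) : extend f (word w) = f w :=
  basis.constr_basis ℝ f w

theorem hom_ext {M : Type*} [AddCommGroup M] [Module ℝ M] {f g : Hqsh →ₗ[ℝ] M}
    (h : ∀ w, f (word w) = g (word w)) : f = g :=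
  basis.ext h

/-- Concatenation of the letter `a` in front of the words. -/
def cons (a : ℕ+) : Hqsh →ₗ[ℝ] Hqsh := extend fun w => word (a :: w)

@[simp] theorem cons_word (a : ℕ+) (w : List ℕ+) : cons a (word w) = word (a :: w) :=
  extend_word _ w

/-- The quasi-shuffle product of two words. -/
def quasiShuffle : List ℕ+ → List ℕ+ → Hqsh
  | [], v => word v
  | a :: u, [] => word (a :: u)
  | a :: u, b :: v =>
      cons a (quasiShuffle u (b :: v)) + cons b (quasiShuffle (a :: u) v)
        + cons (a + b) (quasiShuffle u v)
  termination_by u v => u.length + v.length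

/-- The quasi-shuffle product, as a bilinear map. -/
def mulL : Hqsh →ₗ[ℝ] Hqsh →ₗ[ℝ] Hqsh := extend fun u => extend fun v => quasiShuffle u v

instance : Mul Hqsh := ⟨fun x y => mulL x y⟩

instance : One Hqsh := ⟨word []⟩

theorem one_def : (1 : Hqsh) = word [] := rfl

theorem mul_def (x y : Hqsh) : x * y = mulL x y := rfl

theorem word_mul_word (u v : List ℕ+) : word u * word v = quasiShuffle u v := by
  simp [mul_def, mulL]

theorem cons_mul_cons (a b : ℕ+) (x y : Hqsh) : cons a x * cons b y
    = cons a (x * cons b y) + cons b (cons a x * y) + cons (a + b) (x * y) := by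
  have h : ((mulL.comp (cons a)).compl₂ (cons b)) =
      (mulL.compl₂ (cons b)).compr₂ (cons a) + (mulL.comp (cons a)).compr₂ (cons b)
        + mulL.compr₂ (cons (a + b)) := by
    refine hom_ext fun u => hom_ext fun v => ?_
    simp only [LinearMap.compl₂_apply, LinearMap.comp_apply, LinearMap.add_apply,
      LinearMap.compr₂_apply, cons_word, ← mul_def, word_mul_word]
    rw [quasiShuffle]
  exact congrArg (fun f => f x y) h

theorem mul_add' (x y z : Hqsh) : x * (y + z) = x * y + x * z := map_add (mulL x) y z

theorem add_mul' (x y z : Hqsh) : (x + y) * z = x * z + y * z := by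
  simp [mul_def]

theorem mul_smul' (r : ℝ) (x y : Hqsh) : x * (r • y) = r • (x * y) := map_smul (mulL x) r y

theorem smul_mul' (r : ℝ) (x y : Hqsh) : (r • x) * y = r • (x * y) := by
  simp [mul_def]

theorem zero_mul' (x : Hqsh) : 0 * x = 0 := by simp [mul_def]

theorem mul_zero' (x : Hqsh) : x * 0 = 0 := map_zero (mulL x)

theorem one_mul' (x : Hqsh) : 1 * x = x := by
  have h : mulL 1 = LinearMap.id := hom_ext fun w => by
    rw [← mul_def, one_def, word_mul_word, quasiShuffle, LinearMap.id_apply]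
  exact congrArg (fun f => f x) h

theorem word_mul_comm : ∀ u v : List ℕ+, word u * word v = word v * word u
  | [], v => by
      rw [word_mul_word, word_mul_word]
      cases v <;> simp [quasiShuffle]
  | a :: u, [] => by
      rw [word_mul_word, word_mul_word]
      simp [quasiShuffle]
  | a :: u, b :: v => by
      have h1 := word_mul_comm u (b :: v)
      have h2 := word_mul_comm (a :: u) v
      have h3 := word_mul_comm u v
      simp only [← cons_word] at h1 h2 ⊢
      rw [cons_mul_cons, cons_mul_cons, h1, h2, h3, add_comm a b,
        add_comm (cons a (cons b (word v) * word u))]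
  termination_by u v => u.length + v.length

theorem mul_comm' (x y : Hqsh) : x * y = y * x := by
  have h : mulL = mulL.flip := hom_ext fun u => hom_ext fun v => word_mul_comm u v
  exact congrArg (fun f => f x y) h

theorem cons_mul_cons_mul_cons (a b c : ℕ+) (x y z : Hqsh) :
    cons a x * cons b y * cons c z =
      cons a (x * cons b y * cons c z) + cons b (cons a x * y * cons c z)
        + cons (a + b) (x * y * cons c z) + cons c (cons a x * cons b y * z)
        + cons (a + c) (x * cons b y * z) + cons (b + c) (cons a x * y * z)
        + cons (a + b + c) (x * y * z) := by
  conv_lhs => rw [cons_mul_cons a b, add_mul', add_mul', cons_mul_cons, cons_mul_cons,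
    cons_mul_cons]
  have h : cons c (cons a x * cons b y * z) = cons c (cons a (x * cons b y) * z)
      + cons c (cons b (cons a x * y) * z) + cons c (cons (a + b) (x * y) * z) := by
    rw [cons_mul_cons a b, add_mul', add_mul', map_add, map_add]
  rw [h]
  abel

theorem cons_mul_cons_mul_cons' (a b c : ℕ+) (x y z : Hqsh) :
    cons a x * (cons b y * cons c z) =
      cons a (x * (cons b y * cons c z)) + cons b (cons a x * (y * cons c z))
        + cons (a + b) (x * (y * cons c z)) + cons c (cons a x * (cons b y * z))
        + cons (a + c) (x * (cons b y * z)) + cons (b + c) (cons a x * (y * z))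
        + cons (a + b + c) (x * (y * z)) := by
  conv_lhs => rw [cons_mul_cons b c, mul_add', mul_add', cons_mul_cons, cons_mul_cons,
    cons_mul_cons]
  have h : cons a (x * (cons b y * cons c z)) = cons a (x * cons b (y * cons c z))
      + cons a (x * cons c (cons b y * z)) + cons a (x * cons (b + c) (y * z)) := by
    rw [cons_mul_cons b c, mul_add', mul_add', map_add, map_add]
  rw [h, add_assoc a b c]
  abel

theorem word_mul_assoc : ∀ u v w : List ℕ+,
    word u * word v * word w = word u * (word v * word w)
  | [], v, w => by rw [← one_def, one_mul', one_mul']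
  | a :: u, [], w => by rw [← one_def, mul_comm' _ 1, one_mul', one_mul']
  | a :: u, b :: v, [] => by
      rw [← one_def, mul_comm' _ 1, one_mul', mul_comm' _ 1, one_mul']
  | a :: u, b :: v, c :: w => by
      have h1 := word_mul_assoc u (b :: v) (c :: w)
      have h2 := word_mul_assoc (a :: u) v (c :: w)
      have h3 := word_mul_assoc (a :: u) (b :: v) w
      have h4 := word_mul_assoc u v (c :: w)
      have h5 := word_mul_assoc u (b :: v) w
      have h6 := word_mul_assoc (a :: u) v w
      have h7 := word_mul_assoc u v w
      simp only [← cons_word] at h1 h2 h3 h4 h5 h6 ⊢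
      rw [cons_mul_cons_mul_cons, cons_mul_cons_mul_cons', h1, h2, h3, h4, h5, h6, h7]
  termination_by u v w => u.length + v.length + w.length

theorem mul_assoc' (x y z : Hqsh) : x * y * z = x * (y * z) := by
  have h1 : ∀ u v, mulL (word u * word v) = (mulL (word u)).comp (mulL (word v)) :=
    fun u v => hom_ext fun w => word_mul_assoc u v w
  have h2 : ∀ u, (mulL.flip z).comp (mulL (word u)) = (mulL (word u)).comp (mulL.flip z) :=
    fun u => hom_ext fun v => congrArg (fun f => f z) (h1 u v)
  have h3 : (mulL.flip z).comp (mulL.flip y) = mulL.flip (y * z) :=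
    hom_ext fun u => congrArg (fun f => f y) (h2 u)
  exact congrArg (fun f => f x) h3

/-- The quasi-shuffle algebra. -/
instance : CommRing Hqsh where
  __ := (inferInstance : AddCommGroup Hqsh)
  zero_mul := zero_mul'
  mul_zero := mul_zero'
  one_mul := one_mul'
  mul_one x := by rw [mul_comm', one_mul']
  left_distrib := mul_add'
  right_distrib := add_mul'
  mul_assoc := mul_assoc'
  mul_comm := mul_comm'

instance : Algebra ℝ Hqsh := Algebra.ofModule smul_mul' fun r x y => mul_smul' r x y

/-- The deconcatenation coproduct and the counit. -/
instance : CoalgebraStruct ℝ Hqsh where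
  comul := extend fun w =>
    ∑ i ∈ Finset.range (w.length + 1), word (w.take i) ⊗ₜ[ℝ] word (w.drop i)
  counit := extend fun w => if w = [] then 1 else 0

theorem comul_word (w : List ℕ+) : Coalgebra.comul (R := ℝ) (word w) =
    ∑ i ∈ Finset.range (w.length + 1), word (w.take i) ⊗ₜ[ℝ] word (w.drop i) :=
  extend_word _ w

theorem counit_word (w : List ℕ+) :
    Coalgebra.counit (R := ℝ) (word w) = if w = [] then (1 : ℝ) else 0 :=
  extend_word _ w

theorem comul_cons (a : ℕ+) (x : Hqsh) : Coalgebra.comul (R := ℝ) (cons a x) =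
    word [] ⊗ₜ[ℝ] cons a x + (cons a).rTensor Hqsh (Coalgebra.comul (R := ℝ) x) := by
  have h : (Coalgebra.comul (R := ℝ) (A := Hqsh)).comp (cons a) =
      (TensorProduct.mk ℝ Hqsh Hqsh (word [])).comp (cons a)
        + ((cons a).rTensor Hqsh).comp (Coalgebra.comul (R := ℝ) (A := Hqsh)) := by
    refine hom_ext fun w => ?_
    simp only [LinearMap.comp_apply, LinearMap.add_apply, cons_word, comul_word, map_sum,
      LinearMap.rTensor_tmul, TensorProduct.mk_apply]
    rw [List.length_cons, Finset.sum_range_succ', add_comm]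
    simp
  exact congrArg (fun f => f x) h

instance : Coalgebra ℝ Hqsh where
  coassoc := by
    refine hom_ext fun w => ?_
    induction w with
    | nil => simp [comul_word]
    | cons a w ih =>
      have key : ∀ t : Hqsh ⊗[ℝ] Hqsh,
          TensorProduct.assoc ℝ Hqsh Hqsh Hqsh
            ((Coalgebra.comul (R := ℝ)).rTensor Hqsh ((cons a).rTensor Hqsh t)) =
          word [] ⊗ₜ[ℝ] ((cons a).rTensor Hqsh t) + (cons a).rTensor (Hqsh ⊗[ℝ] Hqsh)
            (TensorProduct.assoc ℝ Hqsh Hqsh Hqsh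
              ((Coalgebra.comul (R := ℝ)).rTensor Hqsh t)) := by
        intro t
        induction t with
        | zero => simp
        | add s t hs ht => simp only [map_add, hs, ht, TensorProduct.tmul_add]; abel
        | tmul x y =>
          simp only [LinearMap.rTensor_tmul, comul_cons, TensorProduct.add_tmul, map_add,
            TensorProduct.assoc_tmul]
          congr 1
          induction Coalgebra.comul (R := ℝ) x with
          | zero => simp
          | add s t hs ht => simp only [map_add, TensorProduct.add_tmul, hs, ht]
          | tmul p q => simp
      have key2 : ∀ t : Hqsh ⊗[ℝ] Hqsh,
          (Coalgebra.comul (R := ℝ)).lTensor Hqsh ((cons a).rTensor Hqsh t) =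
            (cons a).rTensor (Hqsh ⊗[ℝ] Hqsh) ((Coalgebra.comul (R := ℝ)).lTensor Hqsh t) := by
        intro t
        induction t with
        | zero => simp
        | add s t hs ht => simp only [map_add, hs, ht]
        | tmul x y => simp
      simp only [LinearMap.comp_apply, LinearEquiv.coe_coe] at ih ⊢
      rw [← cons_word, comul_cons, map_add, map_add, map_add, key, key2, ih]
      simp only [LinearMap.rTensor_tmul, LinearMap.lTensor_tmul, comul_word [], comul_cons]
      simp [TensorProduct.tmul_add, add_assoc]
  rTensor_counit_comp_comul := by
    refine hom_ext fun w => ?_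
    simp only [LinearMap.comp_apply, comul_word, map_sum, LinearMap.rTensor_tmul, counit_word,
      TensorProduct.mk_apply]
    rw [Finset.sum_eq_single 0]
    · simp
    · intro i hi h0
      have : w.take i ≠ [] := by
        intro h
        simp only [List.take_eq_nil_iff] at h
        rcases h with h | h
        · exact h0 h
        · subst h; simp at hi; exact h0 hi
      simp [this]
    · simp
  lTensor_counit_comp_comul := by
    refine hom_ext fun w => ?_
    simp only [LinearMap.comp_apply, comul_word, map_sum, LinearMap.lTensor_tmul, counit_word,
      TensorProduct.mk_apply, LinearMap.flip_apply]
    rw [Finset.sum_eq_single w.length]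
    · simp
    · intro i hi h0
      have : w.drop i ≠ [] := by
        intro h
        simp only [List.drop_eq_nil_iff] at h
        simp only [Finset.mem_range] at hi
        omega
      simp [this]
    · simp

/-- The reversal of words. -/
def rev : Hqsh →ₗ[ℝ] Hqsh := extend fun w => word w.reverse

end Hqsh

/-- The bounded integrable functions on `ℝ` whose restrictions to the open half-lines
`(0, ∞)` and `(-∞, 0)` are continuous. -/
def PCFun : Submodule ℂ (ℝ → ℂ) where
  carrier := {f | (∃ C : ℝ, ∀ x, ‖f x‖ ≤ C) ∧ Integrable f ∧
    ContinuousOn f (Ioi 0) ∧ ContinuousOn f (Iio 0)}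
  zero_mem' := ⟨⟨0, fun x => by simp⟩, integrable_zero _ _ _, continuousOn_const,
    continuousOn_const⟩
  add_mem' := by
    rintro f g ⟨⟨C, hC⟩, hf, hf1, hf2⟩ ⟨⟨D, hD⟩, hg, hg1, hg2⟩
    exact ⟨⟨C + D, fun x => (norm_add_le _ _).trans (add_le_add (hC x) (hD x))⟩, hf.add hg,
      hf1.add hg1, hf2.add hg2⟩
  smul_mem' := by
    rintro c f ⟨⟨C, hC⟩, hf, hf1, hf2⟩
    refine ⟨⟨‖c‖ * C, fun x => ?_⟩, hf.smul c, hf1.const_smul c, hf2.const_smul c⟩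
    rw [Pi.smul_apply, norm_smul]
    exact mul_le_mul_of_nonneg_left (hC x) (norm_nonneg c)

namespace PCFun

/-- The convolution `(f ⋆ g)(x) = ∫ f(t) g(x - t) dt` of complex functions on `ℝ`. -/
def conv (f g : ℝ → ℂ) : ℝ → ℂ := fun x => ∫ t, f t * g (x - t)

theorem conv_eq (f g : ℝ → ℂ) : conv f g = f ⋆[ContinuousLinearMap.mul ℝ ℂ, volume] g := by
  ext x
  simp [conv, convolution_def]

theorem integrable_conv {f g : ℝ → ℂ} (hf : f ∈ PCFun) (hg : g ∈ PCFun) (x : ℝ) :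
    Integrable fun t => f t * g (x - t) := by
  obtain ⟨C, hC⟩ := hg.1
  exact hf.2.1.mul_bdd (c := C) (hg.2.1.comp_sub_left x).aestronglyMeasurable
    (Filter.Eventually.of_forall fun t => hC _)

theorem continuousAt {f : ℝ → ℂ} (hf : f ∈ PCFun) {x : ℝ} (hx : x ≠ 0) : ContinuousAt f x := by
  rcases lt_or_gt_of_ne hx with h | h
  · exact hf.2.2.2.continuousAt (Iio_mem_nhds h)
  · exact hf.2.2.1.continuousAt (Ioi_mem_nhds h)

theorem continuous_conv {f g : ℝ → ℂ} (hf : f ∈ PCFun) (hg : g ∈ PCFun) :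
    Continuous (conv f g) := by
  obtain ⟨C, hC⟩ := hg.1
  refine continuous_iff_continuousAt.2 fun x => ?_
  refine continuousAt_of_dominated (bound := fun t => ‖f t‖ * C)
    (Filter.Eventually.of_forall fun y => (integrable_conv hf hg y).aestronglyMeasurable)
    (Filter.Eventually.of_forall fun y => Filter.Eventually.of_forall fun t => ?_)
    (hf.2.1.norm.mul_const C) ?_
  · rw [norm_mul]
    exact mul_le_mul_of_nonneg_left (hC _) (norm_nonneg _)
  · have : ∀ᵐ t : ℝ, t ≠ x := by simp [ae_iff]
    filter_upwards [this] with t ht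
    have h : ContinuousAt g (x - t) := continuousAt hg (sub_ne_zero.2 ht.symm)
    exact continuousAt_const.mul
      (ContinuousAt.comp (f := fun y : ℝ => y - t) h (by fun_prop))

theorem conv_mem {f g : ℝ → ℂ} (hf : f ∈ PCFun) (hg : g ∈ PCFun) : conv f g ∈ PCFun := by
  refine ⟨?_, ?_, (continuous_conv hf hg).continuousOn, (continuous_conv hf hg).continuousOn⟩
  · obtain ⟨C, hC⟩ := hg.1
    refine ⟨∫ t, ‖f t‖ * C, fun x => ?_⟩
    refine norm_integral_le_of_norm_le (hf.2.1.norm.mul_const C)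
      (Filter.Eventually.of_forall fun t => ?_)
    rw [norm_mul]
    exact mul_le_mul_of_nonneg_left (hC _) (norm_nonneg _)
  · rw [conv_eq]
    exact hf.2.1.integrable_convolution _ hg.2.1

theorem norm_mem {f : ℝ → ℂ} (hf : f ∈ PCFun) : (fun x => ((‖f x‖ : ℝ) : ℂ)) ∈ PCFun := by
  obtain ⟨C, hC⟩ := hf.1
  exact ⟨⟨C, fun x => by simpa using hC x⟩, hf.2.1.norm.ofReal,
    Complex.continuous_ofReal.comp_continuousOn hf.2.2.1.norm,
    Complex.continuous_ofReal.comp_continuousOn hf.2.2.2.norm⟩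

theorem conv_comm (f g : ℝ → ℂ) : conv f g = conv g f := by
  ext x
  rw [conv, ← integral_sub_left_eq_self _ volume x]
  simp [conv, mul_comm]

theorem conv_assoc {f g h : ℝ → ℂ} (hf : f ∈ PCFun) (hg : g ∈ PCFun) (hh : h ∈ PCFun) :
    conv (conv f g) h = conv f (conv g h) := by
  ext x
  have hex : ∀ {p q : ℝ → ℂ}, p ∈ PCFun → q ∈ PCFun → ∀ y,
      ConvolutionExistsAt p q y (ContinuousLinearMap.mul ℝ ℂ) volume :=
    fun hp hq y => integrable_conv hp hq y
  have hexn : ∀ {p q : ℝ → ℂ}, p ∈ PCFun → q ∈ PCFun → ∀ y,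
      ConvolutionExistsAt (fun t => ‖p t‖) (fun t => ‖q t‖) y
        (ContinuousLinearMap.mul ℝ ℝ) volume := by
    intro p q hp hq y
    have := (integrable_conv hp hq y).norm
    simpa [ConvolutionExistsAt, norm_mul] using this
  simp only [conv_eq]
  refine convolution_assoc _ _ _ _ (fun a b c => by simp [mul_assoc])
    hf.2.1.aestronglyMeasurable hg.2.1.aestronglyMeasurable hh.2.1.aestronglyMeasurable
    (Filter.Eventually.of_forall (hex hf hg)) (Filter.Eventually.of_forall (hexn hg hh)) ?_
  have e := hexn hf (conv_mem (norm_mem hg) (norm_mem hh)) x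
  refine e.congr (Filter.Eventually.of_forall fun t => ?_)
  simp only [ContinuousLinearMap.mul_apply', conv, convolution_def]
  congr 1
  rw [← Real.norm_of_nonneg (integral_nonneg fun s => by positivity), ← Complex.norm_real,
    ← integral_complex_ofReal]
  simp

instance : Mul PCFun := ⟨fun f g => ⟨conv f g, conv_mem f.2 g.2⟩⟩

theorem coe_mul (f g : PCFun) : ((f * g : PCFun) : ℝ → ℂ) = conv f g := rfl

theorem mul_comm' (f g : PCFun) : f * g = g * f := Subtype.ext (conv_comm _ _)

theorem mul_add' (f g h : PCFun) : f * (g + h) = f * g + f * h := by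
  ext x
  simp only [coe_mul, Submodule.coe_add, Pi.add_apply, conv, mul_add]
  exact integral_add (integrable_conv f.2 g.2 x) (integrable_conv f.2 h.2 x)

/-- The convolution algebra (without unit). -/
instance : NonUnitalCommRing PCFun where
  __ := (inferInstance : AddCommGroup PCFun)
  left_distrib := mul_add'
  right_distrib f g h := by rw [mul_comm', mul_add', mul_comm' h f, mul_comm' h g]
  zero_mul f := by ext x; simp [coe_mul, conv]
  mul_zero f := by ext x; simp [coe_mul, conv]
  mul_assoc f g h := Subtype.ext (conv_assoc f.2 g.2 h.2)
  mul_comm := mul_comm'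

instance : IsScalarTower ℂ PCFun PCFun where
  smul_assoc c f g := by
    ext x
    simp [coe_mul, conv, integral_const_mul, mul_assoc]

instance : SMulCommClass ℂ PCFun PCFun where
  smul_comm c f g := by
    ext x
    simp [coe_mul, conv, ← integral_const_mul, mul_left_comm]

theorem indicator_mem {f : ℝ → ℂ} (hf : f ∈ PCFun) : (Ioi (0 : ℝ)).indicator f ∈ PCFun := by
  obtain ⟨C, hC⟩ := hf.1
  refine ⟨⟨C, fun x => (norm_indicator_le_norm_self f x).trans (hC x)⟩,
    hf.2.1.indicator measurableSet_Ioi, ?_, ?_⟩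
  · exact hf.2.2.1.congr fun x hx => indicator_of_mem hx f
  · exact (continuousOn_const (c := (0 : ℂ))).congr fun x hx =>
      indicator_of_notMem (fun h : x ∈ Ioi 0 => lt_asymm (mem_Iio.1 hx) (mem_Ioi.1 h)) f

/-- Multiplication by the indicator function of `(0, ∞)`. -/
def cut : PCFun →ₗ[ℂ] PCFun where
  toFun f := ⟨(Ioi (0 : ℝ)).indicator f, indicator_mem f.2⟩
  map_add' f g := Subtype.ext (indicator_add _ _ _)
  map_smul' c f := Subtype.ext (indicator_const_smul (Ioi 0) c (f : ℝ → ℂ))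

/-- The integral over `ℝ`, multiplicative for the convolution. -/
def integralHom : PCFun →ₙₐ[ℂ] ℂ where
  toFun f := ∫ x, (f : ℝ → ℂ) x
  map_smul' c f := integral_const_mul c _
  map_zero' := by simp
  map_add' f g := integral_add f.2.2.1 g.2.2.1
  map_mul' f g := by
    rw [coe_mul, conv_eq, integral_convolution _ f.2.2.1 g.2.2.1]
    simp

end PCFun

/-- The unital algebra obtained from `PCFun` by adjoining the unit `δ`. -/
abbrev ConvAlg : Type := Unitization ℂ PCFun

namespace ConvAlg

/-- `R (c δ + f) = f · 1_{(0, ∞)}`. -/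
def R : ConvAlg →ₗ[ℂ] ConvAlg :=
  Unitization.inrHom ℂ ℂ PCFun ∘ₗ PCFun.cut ∘ₗ Unitization.sndHom ℂ ℂ PCFun

/-- The complementary projector `id - R`; thus `Rtilde (c δ + f) = c δ + f · 1_{(-∞, 0]}`. -/
def Rtilde : ConvAlg →ₗ[ℂ] ConvAlg := LinearMap.id - R

/-- `Θ (c δ + f) = c + ∫ f`. -/
def Θ : ConvAlg →ₐ[ℂ] ℂ := Unitization.lift PCFun.integralHom

end ConvAlg

namespace Averages

open WithConv PCFun ConvAlg

/-- A character of the quasi-shuffle algebra. -/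
structure IsCharacter (φ : Hqsh →ₗ[ℝ] ℂ) : Prop where
  map_one : φ 1 = 1
  map_mul : ∀ x y, φ (x * y) = φ x * φ y

/-- The character `ι`: it is `1` on words of length at most one and `0` on longer words. -/
def iota : Hqsh →ₗ[ℝ] ℂ := Hqsh.extend fun w => if w.length ≤ 1 then 1 else 0

/-- The inverse of `φ` for the convolution product of linear forms. The value is meaningful
when `toConv φ` is a unit of the convolution algebra. -/
def convInv (φ : Hqsh →ₗ[ℝ] ℂ) : WithConv (Hqsh →ₗ[ℝ] ℂ) := Ring.inverse (toConv φ)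

/-- The complex conjugate of a linear form. -/
def conjForm (φ : Hqsh →ₗ[ℝ] ℂ) : Hqsh →ₗ[ℝ] ℂ := Complex.conjAe.toLinearMap ∘ₗ φ

/-- The algebraic problem of averages: `φ` and `ψ` are characters with
`φ^{*-1} * ψ = ι` and `ψ^{*-1} = conj φ ∘ rev`, where `*` is the convolution dual to
deconcatenation. -/
structure SolvesAlgebraicProblem (φ ψ : Hqsh →ₗ[ℝ] ℂ) : Prop where
  isCharacter_left : IsCharacter φ
  isCharacter_right : IsCharacter ψ
  isUnit_left : IsUnit (toConv φ)
  isUnit_right : IsUnit (toConv ψ)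
  factorization : convInv φ * toConv ψ = toConv iota
  reality : convInv ψ = toConv (conjForm φ ∘ₗ Hqsh.rev)

/-- The linear map `𝓘` from words to the convolution algebra: `∅ ↦ 1`, `ω ↦ γ^ω` on words with one
letter, and `0` on longer words. -/
def calI (γ : ConvAlg) : Hqsh →ₗ[ℝ] ConvAlg := Hqsh.extend fun w =>
  match w with
  | [] => 1
  | [ω] => γ ^ (ω : ℕ)
  | _ :: _ :: _ => 0

/-- `a = 𝓘 - e`, with `e` the unit of the convolution algebra of linear maps. -/
def letterMap (γ : ConvAlg) : WithConv (Hqsh →ₗ[ℝ] ConvAlg) := toConv (calI γ) - 1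

/-- The iterates `(𝓟 a)^[n]` where `𝓟 f = P ∘ f`: `(𝓟 a)^[0] = e` and
`(𝓟 a)^[n+1] = 𝓟 ((𝓟 a)^[n] * a)`. -/
def atkinson (P : ConvAlg →ₗ[ℂ] ConvAlg) (a : WithConv (Hqsh →ₗ[ℝ] ConvAlg)) :
    ℕ → WithConv (Hqsh →ₗ[ℝ] ConvAlg)
  | 0 => 1
  | n + 1 => toConv (P.restrictScalars ℝ ∘ₗ (atkinson P a n * a).ofConv)

/-- `f_ω(x) = (1 / 2π) ∫ exp(-ω β(y)) exp(i x y) dy`. -/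
def fFun (β : ℝ → ℝ) (ω : ℕ+) (x : ℝ) : ℂ :=
  1 / (2 * Real.pi) * ∫ y : ℝ, Complex.exp (-((ω : ℕ) : ℂ) * β y) * Complex.exp (Complex.I * x * y)

/-- The convolution power: `convPow f n = f ⋆ ⋯ ⋆ f` with `n + 1` factors. -/
def convPow (f : ℝ → ℂ) : ℕ → ℝ → ℂ
  | 0 => f
  | n + 1 => conv (convPow f n) f

/-- `iterConv S f h (ω₁, …, ω_r)` is
`((((h ⋆ f^{⋆ω₁}) 1_S) ⋆ f^{⋆ω₂}) 1_S ⋯ ⋆ f^{⋆ω_r}) 1_S`. -/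
def iterConv (S : Set ℝ) (f : ℝ → ℂ) : (ℝ → ℂ) → List ℕ+ → ℝ → ℂ
  | h, [] => h
  | h, ω :: w => iterConv S f (S.indicator (conv h (convPow f ((ω : ℕ) - 1)))) w

/-- `f_{ω₁}(x₁) ⋯ f_{ω_r}(x_r) 1_S(x₁) 1_S(x₁ + x₂) ⋯ 1_S(x₁ + ⋯ + x_r)`. -/
def wordIntegrand (β : ℝ → ℝ) (S : Set ℝ) (w : List ℕ+) (x : Fin w.length → ℝ) : ℂ :=
  (∏ i, fFun β (w.get i) (x i)) * ∏ i, S.indicator (fun _ => (1 : ℂ)) (∑ j ∈ Finset.Iic i, x j)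

/-- The linear form `φ_diffusion`. -/
def phiDiffusion (β : ℝ → ℝ) : Hqsh →ₗ[ℝ] ℂ := Hqsh.extend fun w =>
  (-1) ^ w.length * ∫ x : Fin w.length → ℝ, wordIntegrand β (Ioi 0) w x

end Averages

end

namespace Hqsh

open WithConv Coalgebra

/-! ### The bialgebra structure -/

/-! Write E for `spitzer R γ`, which sends a word of length n to (-1)^n times the iterated
projection R(⋯R(R(γ^ω₁)γ^ω₂)⋯γ^ωₙ). The diffusion form is Θ ∘ E, and the theorem rests on two
algebraic facts and one analytic one.

Multiplicativity. Functions carried by (0, ∞) are closed under convolution, and so are those carried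
by (-∞, 0]; hence R satisfies the Rota–Baxter identity of weight -1 (`isRotaBaxter_R`). That
identity has the shape of the quasi-shuffle recursion on last letters (`snoc_mul_snoc_word`), so E
is an algebra morphism. As Θ is multiplicative, Θ ∘ E is a character.

Factorization. Put I = e + a and Y = `spitzer Rtilde γ ∘ rev`. Then E = e - R(E * a) and Y = e -
Rtilde(a * Y), so E * I = e + Rtilde(E * a) and I * Y = e + R(a * Y). Grouping E * I * Y in the two
possible ways shows that E * I * Y - e takes values both in the kernel and in the image of R, so it
vanishes (`spitzer_factorization`). If Θ(γ) = 1, then Θ ∘ I = ι; with φ = Θ ∘ E, the companion ψ = φ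
* ι therefore has inverse Θ ∘ Y. Since the f_ω are even and real, x ↦ -x turns the integrals over
the nonpositive half-line into those over the positive one, and Θ ∘ Y is the conjugate of φ composed
with `rev`.

Analysis. Fourier inversion gives f_ω ⋆ f_ω' = f_(ω+ω'), so f_ω is a convolution power of γ, and
Fubini identifies Θ of the iterated projections with the integrals over ℝⁿ. There remains Θ(γ) =
exp(-β(0)) = 1, that is β(0) = 0, which has to be extracted from the norm conditions (`beta_zero`):
β has minimum value 0, and equality in |∫ f₁ cos| ≤ ∫ |f₁| forces the minimum to sit at the origin.
-/

theorem rTensor_cons_mul (a : ℕ+) (s : Hqsh ⊗[ℝ] Hqsh) (y : Hqsh) :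
    (cons a).rTensor Hqsh s * (word [] ⊗ₜ[ℝ] y) =
      (cons a).rTensor Hqsh (s * (word [] ⊗ₜ[ℝ] y)) := by
  induction s with
  | zero => simp
  | add s t hs ht => simp only [map_add, add_mul, hs, ht]
  | tmul p q =>
    rw [LinearMap.rTensor_tmul, Algebra.TensorProduct.tmul_mul_tmul,
      Algebra.TensorProduct.tmul_mul_tmul, LinearMap.rTensor_tmul, ← one_def, mul_one, mul_one]

theorem rTensor_cons_mul_rTensor_cons (a b : ℕ+) (s t : Hqsh ⊗[ℝ] Hqsh) :
    (cons a).rTensor Hqsh s * (cons b).rTensor Hqsh t =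
      (cons a).rTensor Hqsh (s * (cons b).rTensor Hqsh t)
        + (cons b).rTensor Hqsh ((cons a).rTensor Hqsh s * t)
        + (cons (a + b)).rTensor Hqsh (s * t) := by
  induction s with
  | zero => simp
  | add s s' hs hs' => simp only [map_add, add_mul, hs, hs']; abel
  | tmul p q =>
    induction t with
    | zero => simp
    | add t t' ht ht' => simp only [map_add, mul_add, ht, ht']; abel
    | tmul r z =>
      simp only [LinearMap.rTensor_tmul, Algebra.TensorProduct.tmul_mul_tmul, cons_mul_cons,
        TensorProduct.add_tmul]

/-- Induction on the first letters: `comul_cons` splits off the cut with empty left part, and on the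
remaining cuts the recursion acts on the left tensor factor alone. This compatibility makes
convolution products of characters characters. -/
theorem comul_word_mul_word : ∀ u v : List ℕ+, comul (R := ℝ) (word u * word v) =
    comul (R := ℝ) (word u) * comul (R := ℝ) (word v)
  | [], v => by
      rw [← one_def, one_mul, one_def, comul_word []]
      simp [← one_def, ← Algebra.TensorProduct.one_def]
  | a :: u, [] => by
      rw [← one_def, mul_one, one_def, comul_word []]
      simp [← one_def, ← Algebra.TensorProduct.one_def]
  | a :: u, b :: v => by
      have h1 := comul_word_mul_word u (b :: v)
      have h2 := comul_word_mul_word (a :: u) v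
      have h3 := comul_word_mul_word u v
      simp only [← cons_word] at h1 h2 ⊢
      have h : cons a (word u) * cons b (word v) = _ := cons_mul_cons a b (word u) (word v)
      rw [h, map_add, map_add, comul_cons, comul_cons, comul_cons, h1, h2, h3]
      simp only [comul_cons, mul_add, add_mul, map_add, rTensor_cons_mul_rTensor_cons,
        rTensor_cons_mul, Algebra.TensorProduct.tmul_mul_tmul,
        mul_comm (word [] ⊗ₜ[ℝ] cons a (word u))]
      rw [← one_def, one_mul, mul_comm (cons b (word v)), h, TensorProduct.tmul_add,
        TensorProduct.tmul_add]
      abel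
  termination_by u v => u.length + v.length

theorem comul_mul (x y : Hqsh) :
    comul (R := ℝ) (x * y) = comul (R := ℝ) x * comul (R := ℝ) y := by
  have h : mulL.compr₂ (comul (R := ℝ) (A := Hqsh)) =
      ((LinearMap.mul ℝ (Hqsh ⊗[ℝ] Hqsh)).comp comul).compl₂ comul :=
    hom_ext fun u => hom_ext fun v => comul_word_mul_word u v
  exact congrArg (fun f => f x y) h

theorem counit_cons (a : ℕ+) (x : Hqsh) : counit (R := ℝ) (cons a x) = 0 := by
  have h : (counit (R := ℝ) (A := Hqsh)).comp (cons a) = 0 :=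
    hom_ext fun w => by simp [counit_word]
  exact congrArg (fun f => f x) h

/-- A linear map on `Hqsh` is multiplicative as soon as it is so on words. -/
theorem map_mul_of_word {B : Type*} [CommRing B] [Algebra ℝ B] (F : Hqsh →ₗ[ℝ] B)
    (h : ∀ u v, F (word u * word v) = F (word u) * F (word v)) (x y : Hqsh) :
    F (x * y) = F x * F y := by
  have h : mulL.compr₂ F = ((LinearMap.mul ℝ B).comp F).compl₂ F :=
    hom_ext fun u => hom_ext fun v => h u v
  exact congrArg (fun f => f x y) h

theorem counit_mul (x y : Hqsh) :
    counit (R := ℝ) (x * y) = counit (R := ℝ) x * counit (R := ℝ) y := by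
  refine map_mul_of_word _ (fun u v => ?_) x y
  rcases u with - | ⟨a, u⟩
  · rw [← one_def, one_mul, one_def, counit_word []]
    simp
  rcases v with - | ⟨b, v⟩
  · rw [← one_def, mul_one, one_def, counit_word []]
    simp
  · rw [← cons_word, ← cons_word, cons_mul_cons]
    simp only [map_add, counit_cons, add_zero, mul_zero]

/-! ### The convolution product on words -/

section Conv

variable {B : Type*} [Ring B] [Algebra ℝ B]

theorem convMul_word (F G : WithConv (Hqsh →ₗ[ℝ] B)) (w : List ℕ+) :
    (F * G) (word w) =
      ∑ i ∈ Finset.range (w.length + 1), F (word (w.take i)) * G (word (w.drop i)) := by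
  rw [LinearMap.convMul_apply, comul_word, map_sum, map_sum]
  rfl

theorem convOne_word (w : List ℕ+) :
    (1 : WithConv (Hqsh →ₗ[ℝ] B)) (word w) = if w = [] then 1 else 0 := by
  rw [LinearMap.convOne_apply, counit_word]
  split_ifs <;> simp

theorem conv_ext {F G : WithConv (Hqsh →ₗ[ℝ] B)} (h : ∀ w, F (word w) = G (word w)) : F = G :=
  ofConv_injective (hom_ext h)

theorem convMul_nil (F G : WithConv (Hqsh →ₗ[ℝ] B)) :
    (F * G) (word []) = F (word []) * G (word []) := by
  rw [convMul_word]
  simp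

/-- In (K * G)(w) the cut after the last letter contributes K(w), and every other cut evaluates K on
a shorter word. -/
theorem eq_zero_of_convMul_eq_zero {K G : WithConv (Hqsh →ₗ[ℝ] B)} (hG : G (word []) = 1)
    (h : K * G = 0) : K = 0 := by
  refine conv_ext fun w => ?_
  induction hn : w.length using Nat.strong_induction_on generalizing w with
  | _ n ih =>
    have hw := congrArg (fun F => F (word w)) h
    simp only [convMul_word] at hw
    rw [Finset.sum_range_succ, Finset.sum_eq_zero] at hw
    · simpa [hG] using hw
    · intro i hi
      rw [Finset.mem_range] at hi
      rw [ih (w.take i).length (by simp; omega) _ rfl]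
      exact zero_mul _

/-- In the convolution algebra, a right inverse of a unipotent element is an inverse. -/
theorem convMul_eq_one_comm {F G : WithConv (Hqsh →ₗ[ℝ] B)} (hF : F (word []) = 1)
    (h : F * G = 1) : G * F = 1 := by
  have hG : G (word []) = 1 := by
    have := congrArg (fun K => K (word [])) h
    rwa [convMul_nil, hF, convOne_word, one_mul, if_pos rfl] at this
  rw [← sub_eq_zero]
  refine eq_zero_of_convMul_eq_zero hG ?_
  rw [sub_mul, mul_assoc, h]
  simp

end Conv

end Hqsh

/-! ### Characters and their convolution products -/

namespace Averages

open WithConv Hqsh Coalgebra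

theorem IsCharacter.convMul {F G : Hqsh →ₗ[ℝ] ℂ} (hF : IsCharacter F) (hG : IsCharacter G) :
    IsCharacter (toConv F * toConv G).ofConv := by
  constructor
  · change (toConv F * toConv G) 1 = 1
    rw [one_def, convMul_nil, ← one_def]
    change F 1 * G 1 = 1
    rw [hF.map_one, hG.map_one, one_mul]
  · intro x y
    change LinearMap.mul' ℝ ℂ (TensorProduct.map F G (comul (x * y))) =
      LinearMap.mul' ℝ ℂ (TensorProduct.map F G (comul x)) *
        LinearMap.mul' ℝ ℂ (TensorProduct.map F G (comul y))
    rw [comul_mul]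
    generalize comul (R := ℝ) x = s
    generalize comul (R := ℝ) y = t
    induction s with
    | zero => simp
    | add s s' hs hs' => simp only [map_add, add_mul, hs, hs']
    | tmul p q =>
      induction t with
      | zero => simp
      | add t t' ht ht' => simp only [map_add, mul_add, ht, ht']
      | tmul r z =>
        simp only [Algebra.TensorProduct.tmul_mul_tmul, TensorProduct.map_tmul,
          LinearMap.mul'_apply, hF.map_mul, hG.map_mul]
        ring

theorem iota_cons (a : ℕ+) (x : Hqsh) : iota (cons a x) = (counit (R := ℝ) x : ℝ) := by
  have h : iota.comp (cons a) = (Algebra.linearMap ℝ ℂ).comp counit :=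
    hom_ext fun w => by cases w <;> simp [iota, counit_word]
  exact congrArg (fun f => f x) h

/-- After removal of the first letter, ι becomes the counit. In the product of two nonempty words
the first two branches have tails killed by the counit, so only the contracted branch survives. -/
theorem isCharacter_iota : IsCharacter iota := by
  have h1 : iota (word []) = 1 := by simp [iota]
  refine ⟨h1, map_mul_of_word _ fun u v => ?_⟩
  rcases u with - | ⟨a, u⟩
  · rw [h1, ← one_def, one_mul, one_mul]
  rcases v with - | ⟨b, v⟩
  · rw [h1, ← one_def, mul_one, mul_one]
  · rw [← cons_word, ← cons_word, cons_mul_cons]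
    simp only [map_add, iota_cons, counit_mul, counit_cons]
    simp

end Averages

namespace Hqsh

/-! ### The quasi-shuffle product and the last letters -/

/-- Concatenation of the letter `a` behind the words. -/
noncomputable def snoc (a : ℕ+) : Hqsh →ₗ[ℝ] Hqsh := extend fun w => word (w ++ [a])

@[simp] theorem snoc_word (a : ℕ+) (w : List ℕ+) : snoc a (word w) = word (w ++ [a]) :=
  extend_word _ w

theorem snoc_cons (a b : ℕ+) (x : Hqsh) : snoc a (cons b x) = cons b (snoc a x) := by
  have h : (snoc a).comp (cons b) = (cons b).comp (snoc a) := hom_ext fun w => by simp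
  exact congrArg (fun f => f x) h

/-- The quasi-shuffle product looks the same from either end of the words. The last-letter form is
the one needed, because the iterated projections are built by appending letters. -/
theorem snoc_mul_snoc_word (a b : ℕ+) : ∀ u v : List ℕ+,
    snoc a (word u) * snoc b (word v) = snoc a (word u * snoc b (word v))
      + snoc b (snoc a (word u) * word v) + snoc (a + b) (word u * word v)
  | [], [] => by
      have h : ∀ c, snoc c (word []) = cons c (word []) := fun c => by simp
      rw [h, h, cons_mul_cons, ← one_def]
      simp only [one_mul, mul_one]
      rw [one_def, ← h b, ← h a, ← snoc_cons, ← snoc_cons, h, h, h]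
      abel
  | [], d :: v => by
      have ih := snoc_mul_snoc_word a b [] v
      have h : ∀ c, snoc c (word []) = cons c (word []) := fun c => by simp
      rw [h] at ih ⊢
      rw [← cons_word, snoc_cons b d, cons_mul_cons a d, ih, ← one_def, cons_mul_cons a d]
      simp only [one_mul, map_add, snoc_cons]
      abel
  | c :: u, [] => by
      have ih := snoc_mul_snoc_word a b u []
      have h : ∀ c, snoc c (word []) = cons c (word []) := fun c => by simp
      rw [h] at ih ⊢
      rw [← cons_word, snoc_cons a c, cons_mul_cons c b, ih, ← one_def, cons_mul_cons c b]
      simp only [mul_one, map_add, snoc_cons]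
      abel
  | c :: u, d :: v => by
      have h1 := snoc_mul_snoc_word a b u (d :: v)
      have h2 := snoc_mul_snoc_word a b (c :: u) v
      have h3 := snoc_mul_snoc_word a b u v
      simp only [← cons_word, snoc_cons] at h1 h2 ⊢
      rw [cons_mul_cons c d, h1, h2, h3, cons_mul_cons c d, cons_mul_cons c d, cons_mul_cons c d]
      simp only [map_add, snoc_cons]
      abel
  termination_by u v => u.length + v.length

end Hqsh

/-! ### Cutting along half-lines and the Rota–Baxter identity -/

namespace PCFun

theorem cut_apply (f : PCFun) : (cut f : ℝ → ℂ) = (Ioi (0 : ℝ)).indicator f := rfl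

theorem coe_sub_cut (f : PCFun) : ((f - cut f : PCFun) : ℝ → ℂ) = (Iic (0 : ℝ)).indicator f := by
  rw [Submodule.coe_sub, cut_apply, ← compl_Ioi, indicator_compl]

theorem cut_cut (f : PCFun) : cut (cut f) = cut f :=
  Subtype.ext (by rw [cut_apply, cut_apply, indicator_indicator, inter_self])

/-- A sum of two positive numbers is positive: for x ≤ 0, no t has both t and x - t in (0, ∞). -/
theorem cut_mul_cut (f g : PCFun) : cut (cut f * cut g) = cut f * cut g := by
  refine Subtype.ext ?_
  rw [cut_apply, indicator_eq_self, Function.support_subset_iff']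
  intro x hx
  rw [coe_mul, conv, cut_apply, cut_apply]
  refine integral_eq_zero_of_ae (Filter.Eventually.of_forall fun t => ?_)
  simp only [mem_Ioi, not_lt] at hx
  by_cases ht : 0 < t
  · have : x - t ∉ Ioi (0 : ℝ) := by simp only [mem_Ioi]; linarith
    simp [indicator_of_notMem this]
  · simp [ht]

theorem cut_mul_compl_cut (f g : PCFun) : cut ((f - cut f) * (g - cut g)) = 0 := by
  refine Subtype.ext ?_
  rw [cut_apply, coe_mul, coe_sub_cut, coe_sub_cut]
  refine indicator_eq_zero'.2 ?_
  rw [disjoint_comm, ← Set.subset_compl_iff_disjoint_right, compl_def]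
  intro x hx
  rw [mem_Ioi] at hx
  simp only [Function.mem_support, not_not, mem_ofPred_eq, conv]
  refine integral_eq_zero_of_ae (Filter.Eventually.of_forall fun t => ?_)
  by_cases ht : t ≤ 0
  · have : x - t ∉ Iic (0 : ℝ) := by simp only [mem_Iic]; linarith
    simp [indicator_of_notMem this]
  · simp [ht]

end PCFun

namespace ConvAlg

open PCFun

/-- The Rota–Baxter identity of weight `-1`. -/
def IsRotaBaxter (P : ConvAlg →ₗ[ℂ] ConvAlg) : Prop :=
  ∀ x y, P x * P y = P (P x * y + x * P y - x * y)

theorem R_apply (x : ConvAlg) : R x = (cut x.snd : ConvAlg) := rfl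

theorem Rtilde_apply (x : ConvAlg) : Rtilde x = x - R x := rfl

theorem R_R (x : ConvAlg) : R (R x) = R x := by
  simp [R_apply, cut_cut]

theorem R_Rtilde (x : ConvAlg) : R (Rtilde x) = 0 := by
  rw [Rtilde_apply, map_sub, R_R, sub_self]

/-- Expanding the vanishing cut of (f - cut f) ⋆ (g - cut g) gives the identity on functions; the
contributions of the multiples of δ cancel. -/
theorem isRotaBaxter_R : IsRotaBaxter R := by
  intro x y
  have h := cut_mul_compl_cut x.snd y.snd
  rw [sub_mul, mul_sub, mul_sub, map_sub, map_sub, map_sub, cut_mul_cut] at h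
  simp only [R_apply]
  rw [← Unitization.inr_mul]
  congr 1
  rw [sub_eq_add_neg]
  simp only [Unitization.snd_add, Unitization.snd_neg, Unitization.snd_mul, Unitization.snd_inr,
    Unitization.fst_inr, zero_smul, zero_add, add_zero, map_add, map_neg, map_smul, cut_cut]
  rw [← sub_eq_zero, ← h]
  abel

end ConvAlg

/-! ### Signed iterated projections as an algebra morphism -/

namespace Averages

open WithConv PCFun ConvAlg Hqsh

/-- The iterated projections `P (⋯ P (P (γ ^ ω₁) γ ^ ω₂) ⋯ γ ^ ω_r)`. -/
noncomputable def iterProj (P : ConvAlg →ₗ[ℂ] ConvAlg) (γ : ConvAlg) (w : List ℕ+) : ConvAlg :=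
  w.foldl (fun x (ω : ℕ+) => P (x * γ ^ (ω : ℕ))) 1

/-- The alternating sum `∑ (-1) ^ n (𝓟 a)^[n]` as a linear map. -/
noncomputable def spitzer (P : ConvAlg →ₗ[ℂ] ConvAlg) (γ : ConvAlg) : Hqsh →ₗ[ℝ] ConvAlg :=
  extend fun w => (-1) ^ w.length * iterProj P γ w

variable {P : ConvAlg →ₗ[ℂ] ConvAlg} {γ : ConvAlg}

theorem iterProj_snoc (w : List ℕ+) (ω : ℕ+) :
    iterProj P γ (w ++ [ω]) = P (iterProj P γ w * γ ^ (ω : ℕ)) := by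
  simp [iterProj]

theorem spitzer_word (w : List ℕ+) :
    spitzer P γ (word w) = (-1) ^ w.length * iterProj P γ w := extend_word _ w

theorem spitzer_nil : spitzer P γ (word []) = 1 := by
  simp [spitzer_word, iterProj]

theorem neg_one_pow_mul_eq_smul (n : ℕ) (x : ConvAlg) : (-1) ^ n * x = ((-1) ^ n : ℂ) • x := by
  rcases neg_one_pow_eq_or ConvAlg n with h | h <;>
  rcases neg_one_pow_eq_or ℂ n with h' | h' <;>
  rcases Nat.even_or_odd n with h'' | h'' <;>
  simp [h''.neg_one_pow]

theorem spitzer_snoc_word (w : List ℕ+) (ω : ℕ+) :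
    spitzer P γ (word (w ++ [ω])) = - P (spitzer P γ (word w) * γ ^ (ω : ℕ)) := by
  rw [spitzer_word, spitzer_word, iterProj_snoc, neg_one_pow_mul_eq_smul,
    neg_one_pow_mul_eq_smul, smul_mul_assoc, map_smul, List.length_append, pow_add]
  simp

theorem spitzer_snoc (ω : ℕ+) (x : Hqsh) :
    spitzer P γ (snoc ω x) = - P (spitzer P γ x * γ ^ (ω : ℕ)) := by
  have h : (spitzer P γ).comp (snoc ω) = - (P.restrictScalars ℝ).comp
      ((LinearMap.mulRight ℝ (γ ^ (ω : ℕ))).comp (spitzer P γ)) :=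
    hom_ext fun w => by simpa using spitzer_snoc_word w ω
  exact congrArg (fun f => f x) h

/-- Induction on total length. The three terms of the Rota–Baxter identity match the three branches
of the last-letter recursion; γ^(a+b) = γ^a γ^b accounts for the contracted letter, and the signs
(-1)^n absorb the weight -1. -/
theorem spitzer_word_mul_word (hP : IsRotaBaxter P) (u v : List ℕ+) :
    spitzer P γ (word u * word v) = spitzer P γ (word u) * spitzer P γ (word v) := by
  induction hn : u.length + v.length using Nat.strong_induction_on generalizing u v with
  | _ n ih =>
    rcases List.eq_nil_or_concat u with rfl | ⟨u, a, rfl⟩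
    · rw [spitzer_nil, ← one_def, one_mul, one_mul]
    rcases List.eq_nil_or_concat v with rfl | ⟨v, b, rfl⟩
    · rw [spitzer_nil, ← one_def, mul_one, mul_one]
    simp only [List.concat_eq_append, List.length_append, List.length_singleton] at hn ⊢
    have h1 := ih _ (by simp; omega) u (v ++ [b]) rfl
    have h2 := ih _ (by simp; omega) (u ++ [a]) v rfl
    have h3 := ih _ (by omega) u v rfl
    simp only [← snoc_word] at h1 h2 ⊢
    rw [snoc_mul_snoc_word, map_add, map_add, spitzer_snoc, spitzer_snoc, spitzer_snoc, h1, h2, h3,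
      spitzer_snoc, spitzer_snoc, neg_mul_neg, hP, PNat.add_coe, pow_add, ← neg_add,
      ← neg_add, ← map_add, ← map_add, ← map_neg P]
    congr 1
    ring

theorem spitzer_mul (hP : IsRotaBaxter P) (x y : Hqsh) :
    spitzer P γ (x * y) = spitzer P γ x * spitzer P γ y :=
  map_mul_of_word _ (spitzer_word_mul_word hP) x y

/-! ### The letter map -/

theorem letterMap_nil : letterMap γ (word []) = 0 := by
  change calI γ (word []) - (1 : WithConv (Hqsh →ₗ[ℝ] ConvAlg)) (word []) = 0
  rw [convOne_word]
  simp [calI]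

theorem letterMap_singleton (ω : ℕ+) : letterMap γ (word [ω]) = γ ^ (ω : ℕ) := by
  change calI γ (word [ω]) - (1 : WithConv (Hqsh →ₗ[ℝ] ConvAlg)) (word [ω]) = _
  rw [convOne_word]
  simp [calI]

theorem letterMap_of_length {w : List ℕ+} (hw : w.length ≠ 1) : letterMap γ (word w) = 0 := by
  match w with
  | [] => exact letterMap_nil
  | [ω] => simp at hw
  | a :: b :: w =>
    change calI γ (word (a :: b :: w)) - (1 : WithConv (Hqsh →ₗ[ℝ] ConvAlg)) (word _) = _
    rw [convOne_word]
    simp [calI]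

theorem convMul_letterMap_nil (F : WithConv (Hqsh →ₗ[ℝ] ConvAlg)) :
    (F * letterMap γ) (word []) = 0 := by
  rw [convMul_nil, letterMap_nil, mul_zero]

theorem letterMap_convMul_nil (F : WithConv (Hqsh →ₗ[ℝ] ConvAlg)) :
    (letterMap γ * F) (word []) = 0 := by
  rw [convMul_nil, letterMap_nil, zero_mul]

theorem convMul_letterMap_snoc (F : WithConv (Hqsh →ₗ[ℝ] ConvAlg)) (w : List ℕ+) (ω : ℕ+) :
    (F * letterMap γ) (word (w ++ [ω])) = F (word w) * γ ^ (ω : ℕ) := by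
  rw [convMul_word, Finset.sum_eq_single w.length]
  · rw [List.take_left, List.drop_left, letterMap_singleton]
  · intro i hi h
    rw [letterMap_of_length, mul_zero]
    simp only [Finset.mem_range, List.length_append, List.length_singleton] at hi
    simp only [List.length_drop, List.length_append, List.length_singleton]
    omega
  · intro h
    simp at h

theorem letterMap_convMul_cons (F : WithConv (Hqsh →ₗ[ℝ] ConvAlg)) (w : List ℕ+) (ω : ℕ+) :
    (letterMap γ * F) (word (ω :: w)) = γ ^ (ω : ℕ) * F (word w) := by
  rw [convMul_word, Finset.sum_eq_single 1]
  · simp [letterMap_singleton]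
  · intro i hi h
    rw [letterMap_of_length, zero_mul]
    simp only [Finset.mem_range, List.length_cons] at hi
    simp only [List.length_take, List.length_cons]
    omega
  · intro h
    simp at h

/-- As a lives on single letters, only the cut before the last letter contributes at each stage. -/
theorem atkinson_word (w : List ℕ+) :
    atkinson P (letterMap γ) w.length (word w) = iterProj P γ w := by
  induction w using List.reverseRecOn with
  | nil => simp [atkinson, iterProj, convOne_word, -LinearMap.convOne_apply]
  | append_singleton w ω ih =>
    rw [List.length_append, List.length_singleton, iterProj_snoc, ← ih, ← convMul_letterMap_snoc]
    rfl

/-! ### The factorization -/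

theorem spitzer_eq (P : ConvAlg →ₗ[ℂ] ConvAlg) (γ : ConvAlg) : toConv (spitzer P γ) =
    1 - toConv (P.restrictScalars ℝ ∘ₗ (toConv (spitzer P γ) * letterMap γ).ofConv) := by
  refine conv_ext fun w => ?_
  change spitzer P γ (word w) = (1 : WithConv (Hqsh →ₗ[ℝ] ConvAlg)) (word w) -
    P ((toConv (spitzer P γ) * letterMap γ) (word w))
  rw [convOne_word]
  induction w using List.reverseRecOn with
  | nil => rw [convMul_letterMap_nil, spitzer_nil]; simp
  | append_singleton w ω _ => rw [convMul_letterMap_snoc, spitzer_snoc_word]; simp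

/-- Reversal turns the last letter into the first, so a moves to the left of the unknown;
commutativity of the convolution algebra of functions is used here. -/
theorem spitzer_comp_rev_eq (P : ConvAlg →ₗ[ℂ] ConvAlg) (γ : ConvAlg) :
    toConv (spitzer P γ ∘ₗ rev) = 1 - toConv (P.restrictScalars ℝ ∘ₗ
      (letterMap γ * toConv (spitzer P γ ∘ₗ rev)).ofConv) := by
  have hrev : ∀ w, rev (word w) = word w.reverse := extend_word _
  refine conv_ext fun w => ?_
  change spitzer P γ (rev (word w)) = (1 : WithConv (Hqsh →ₗ[ℝ] ConvAlg)) (word w) -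
    P ((letterMap γ * toConv (spitzer P γ ∘ₗ rev)) (word w))
  rw [convOne_word]
  cases w with
  | nil => rw [letterMap_convMul_nil, hrev, List.reverse_nil, spitzer_nil]; simp
  | cons ω w =>
    rw [letterMap_convMul_cons, hrev, List.reverse_cons, spitzer_snoc_word]
    simp [hrev, mul_comm]

/-- For values fixed by R the Rota–Baxter identity reads xy = R(xy): the image of R is closed under
products. The next lemma is the analogue for the kernel. -/
theorem R_convMul_apply {F G : WithConv (Hqsh →ₗ[ℝ] ConvAlg)} (hF : ∀ x, R (F x) = F x)
    (hG : ∀ x, R (G x) = G x) (w : List ℕ+) : R ((F * G) (word w)) = (F * G) (word w) := by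
  rw [convMul_word, map_sum]
  refine Finset.sum_congr rfl fun i _ => ?_
  have := isRotaBaxter_R (F (word (w.take i))) (G (word (w.drop i)))
  rw [hF, hG, add_sub_cancel_right] at this
  exact this.symm

theorem R_convMul_apply_eq_zero {F G : WithConv (Hqsh →ₗ[ℝ] ConvAlg)} (hF : ∀ x, R (F x) = 0)
    (hG : ∀ x, R (G x) = 0) (w : List ℕ+) : R ((F * G) (word w)) = 0 := by
  rw [convMul_word, map_sum]
  refine Finset.sum_eq_zero fun i _ => ?_
  have := isRotaBaxter_R (F (word (w.take i))) (G (word (w.drop i)))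
  rw [hF, hG, mul_zero, zero_mul, mul_zero, add_zero, zero_sub, map_neg] at this
  exact neg_eq_zero.1 this.symm

theorem spitzer_factorization (γ : ConvAlg) : toConv (spitzer R γ) *
    (toConv (calI γ) * toConv (spitzer Rtilde γ ∘ₗ rev)) = 1 := by
  set E := toConv (spitzer R γ)
  set Y := toConv (spitzer Rtilde γ ∘ₗ rev)
  set RE := toConv (R.restrictScalars ℝ ∘ₗ (E * letterMap γ).ofConv)
  set TE := toConv (Rtilde.restrictScalars ℝ ∘ₗ (E * letterMap γ).ofConv)
  set RY := toConv (R.restrictScalars ℝ ∘ₗ (letterMap γ * Y).ofConv)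
  set TY := toConv (Rtilde.restrictScalars ℝ ∘ₗ (letterMap γ * Y).ofConv)
  have hE : E = 1 - RE := spitzer_eq R γ
  have hY : Y = 1 - TY := spitzer_comp_rev_eq Rtilde γ
  have hTE : TE = E * letterMap γ - RE := rfl
  have hTY : TY = letterMap γ * Y - RY := rfl
  have hI : toConv (calI γ) = 1 + letterMap γ := by rw [letterMap]; abel
  -- Absorbing I into E leaves only terms with values in the kernel of R, apart from e.
  have h1 : E * (toConv (calI γ) * Y) = 1 + (TE - TY - TE * TY) := by
    have : E * toConv (calI γ) = 1 + TE := by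
      rw [hI, mul_add, mul_one, hTE]
      nth_rewrite 1 [hE]
      abel
    rw [← mul_assoc, this, hY, add_mul, one_mul, mul_sub TE, mul_one]
    abel
  -- Absorbing I into Y instead leaves only terms fixed by R.
  have h2 : E * (toConv (calI γ) * Y) = 1 + (RY - RE - RE * RY) := by
    have : toConv (calI γ) * Y = 1 + RY := by
      rw [hI, add_mul, one_mul, ← sub_eq_zero]
      have : RY = letterMap γ * Y - TY := by rw [hTY]; abel
      rw [this]
      nth_rewrite 1 [hY]
      abel
    rw [this, hE, sub_mul, one_mul, mul_add RE, mul_one]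
    abel
  rw [h1, add_eq_left]
  refine conv_ext fun w => ?_
  have h3 : TE - TY - TE * TY = RY - RE - RE * RY := add_left_cancel (h1.symm.trans h2)
  have hz : R ((TE - TY - TE * TY) (word w)) = 0 := by
    change R (TE (word w) - TY (word w) - (TE * TY) (word w)) = 0
    rw [map_sub, map_sub, R_convMul_apply_eq_zero (fun x => R_Rtilde _) (fun x => R_Rtilde _)]
    have e1 : R (TE (word w)) = 0 := R_Rtilde _
    have e2 : R (TY (word w)) = 0 := R_Rtilde _
    rw [e1, e2, sub_zero, sub_zero]
  have hs : R ((RY - RE - RE * RY) (word w)) = (RY - RE - RE * RY) (word w) := by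
    change R (RY (word w) - RE (word w) - (RE * RY) (word w)) =
      RY (word w) - RE (word w) - (RE * RY) (word w)
    rw [map_sub, map_sub, R_convMul_apply (fun x => R_R _) (fun x => R_R _)]
    have e1 : R (RE (word w)) = RE (word w) := R_R _
    have e2 : R (RY (word w)) = RY (word w) := R_R _
    rw [e1, e2]
  rw [h3] at hz ⊢
  rw [← hs, hz]
  rfl

/-! ### Evaluation by Θ and the companion character -/

/-- The linear form `Θ ∘ F`. -/
noncomputable def evalΘ (F : Hqsh →ₗ[ℝ] ConvAlg) : Hqsh →ₗ[ℝ] ℂ :=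
  (Θ.toLinearMap.restrictScalars ℝ) ∘ₗ F

theorem evalΘ_apply (F : Hqsh →ₗ[ℝ] ConvAlg) (x : Hqsh) : evalΘ F x = Θ (F x) := rfl

theorem evalΘ_convMul (F G : WithConv (Hqsh →ₗ[ℝ] ConvAlg)) :
    toConv (evalΘ (F * G).ofConv) = toConv (evalΘ F.ofConv) * toConv (evalΘ G.ofConv) := by
  refine conv_ext fun w => ?_
  change Θ ((F * G) (word w)) = _
  rw [convMul_word, convMul_word, map_sum]
  exact Finset.sum_congr rfl fun i _ => map_mul Θ _ _

theorem evalΘ_convOne : toConv (evalΘ (1 : WithConv (Hqsh →ₗ[ℝ] ConvAlg)).ofConv) = 1 := by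
  refine conv_ext fun w => ?_
  change Θ ((1 : WithConv (Hqsh →ₗ[ℝ] ConvAlg)) (word w)) = _
  rw [convOne_word, convOne_word]
  split_ifs
  · exact map_one Θ
  · exact map_zero Θ

theorem evalΘ_calI (hγ : Θ γ = 1) : evalΘ (calI γ) = iota := by
  refine hom_ext fun w => ?_
  rw [evalΘ_apply]
  match w with
  | [] => simp [calI, iota]
  | [ω] => simp [calI, iota, hγ]
  | a :: b :: w => simp [calI, iota]

theorem isCharacter_evalΘ_spitzer (hP : IsRotaBaxter P) : IsCharacter (evalΘ (spitzer P γ)) where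
  map_one := by rw [evalΘ_apply, one_def, spitzer_nil, map_one]
  map_mul x y := by simp only [evalΘ_apply, spitzer_mul hP, map_mul]

theorem evalΘ_spitzer_factorization (hγ : Θ γ = 1) : toConv (evalΘ (spitzer R γ)) *
    (toConv iota * toConv (evalΘ (spitzer Rtilde γ ∘ₗ rev))) = 1 := by
  rw [← evalΘ_convOne, ← spitzer_factorization γ, evalΘ_convMul, evalΘ_convMul, ← evalΘ_calI hγ]

theorem convInv_eq {φ : Hqsh →ₗ[ℝ] ℂ} {G : WithConv (Hqsh →ₗ[ℝ] ℂ)} (hφ : φ (word []) = 1)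
    (h : toConv φ * G = 1) : IsUnit (toConv φ) ∧ convInv φ = G :=
  have h' := convMul_eq_one_comm (F := toConv φ) hφ h
  ⟨⟨⟨_, _, h, h'⟩, rfl⟩, Ring.inverse_unit ⟨toConv φ, G, h, h'⟩⟩

/-- The companion of the character `Θ ∘ spitzer R γ`. -/
noncomputable def companion (γ : ConvAlg) : Hqsh →ₗ[ℝ] ℂ :=
  (toConv (evalΘ (spitzer R γ)) * toConv iota).ofConv

theorem companion_isUnit_and_convInv (hγ : Θ γ = 1) : IsUnit (toConv (companion γ)) ∧
    convInv (companion γ) = toConv (evalΘ (spitzer Rtilde γ ∘ₗ rev)) := by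
  refine convInv_eq ?_ ?_
  · change (toConv (evalΘ (spitzer R γ)) * toConv iota) (word []) = 1
    rw [convMul_nil]
    change Θ (spitzer R γ (word [])) * iota (word []) = 1
    rw [spitzer_nil]
    simp [iota]
  · rw [← evalΘ_spitzer_factorization hγ, ← mul_assoc]
    rfl

theorem convInv_companion_rev (hγ : Θ γ = 1) (w : List ℕ+) :
    convInv (companion γ) (rev (word w)) = Θ (spitzer Rtilde γ (word w)) := by
  rw [(companion_isUnit_and_convInv hγ).2]
  change Θ (spitzer Rtilde γ (rev (rev (word w)))) = _
  simp [rev]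

/-- With ψ = φ * ι the relation φ^{*-1} * ψ = ι is automatic, and the factorization computes
ψ^{*-1}; the hypothesis `hr` is exactly what the reality condition still requires. -/
theorem solvesAlgebraicProblem_companion (hγ : Θ γ = 1)
    (hr : ∀ w, Θ (spitzer Rtilde γ (word w)) =
      starRingEnd ℂ (Θ (spitzer R γ (word w)))) :
    SolvesAlgebraicProblem (evalΘ (spitzer R γ)) (companion γ) := by
  have h := convInv_eq (by rw [evalΘ_apply, spitzer_nil, map_one]) (evalΘ_spitzer_factorization hγ)
  refine ⟨isCharacter_evalΘ_spitzer isRotaBaxter_R,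
    (isCharacter_evalΘ_spitzer isRotaBaxter_R).convMul isCharacter_iota, h.1,
    (companion_isUnit_and_convInv hγ).1, ?_, ?_⟩
  · have h1 : convInv (evalΘ (spitzer R γ)) * toConv (evalΘ (spitzer R γ)) = 1 :=
      Ring.inverse_mul_cancel _ h.1
    change convInv (evalΘ (spitzer R γ)) * (toConv (evalΘ (spitzer R γ)) * toConv iota) = _
    rw [← mul_assoc, h1, one_mul]
  · rw [(companion_isUnit_and_convInv hγ).2]
    refine conv_ext fun w => ?_
    change Θ (spitzer Rtilde γ (rev (word w))) =
      starRingEnd ℂ (Θ (spitzer R γ (rev (word w))))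
    rw [rev, extend_word, hr]

end Averages

/-! ### The functions f_ω: Fourier inversion and the convolution semigroup -/

namespace Averages

open PCFun Filter Topology FourierTransform

/-- The multiplier `exp (-ω β)`, the Fourier transform of `f_ω`. -/
noncomputable def damping (β : ℝ → ℝ) (ω : ℕ+) (y : ℝ) : ℂ :=
  Complex.exp (-((ω : ℕ) : ℂ) * β y)

variable {β : ℝ → ℝ} {ω : ℕ+}

theorem continuous_damping (hβ : Continuous β) : Continuous (damping β ω) := by
  unfold damping
  fun_prop

theorem norm_damping (y : ℝ) : ‖damping β ω y‖ = Real.exp (-(ω : ℕ) * β y) := by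
  rw [damping, Complex.norm_exp]
  simp

theorem damping_mul (ω ω' : ℕ+) (y : ℝ) :
    damping β ω y * damping β ω' y = damping β (ω + ω') y := by
  rw [damping, damping, damping, ← Complex.exp_add]
  congr 1
  push_cast
  ring

theorem norm_cexp_I_mul (x y : ℝ) : ‖Complex.exp (Complex.I * x * y)‖ = 1 := by
  rw [Complex.norm_exp]
  simp

theorem fFun_eq (x : ℝ) : fFun β ω x =
    1 / (2 * Real.pi) * ∫ y : ℝ, damping β ω y * Complex.exp (Complex.I * x * y) := rfl

/-- Otherwise the integral defining f_ω takes its default value 0 at every x, and the norm would be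
0 rather than 1. -/
theorem integrable_damping (hβ : Continuous β) (h : ∫ x : ℝ, ‖fFun β ω x‖ = 1) :
    Integrable (damping β ω) := by
  by_contra hd
  have h0 : ∀ x, fFun β ω x = 0 := by
    intro x
    rw [fFun_eq, integral_undef, mul_zero]
    refine fun hi => hd (hi.congr' (continuous_damping hβ).aestronglyMeasurable
      (Eventually.of_forall fun y => ?_))
    rw [norm_mul, norm_cexp_I_mul, mul_one]
  simp [h0] at h

theorem integrable_damping_mul (hβ : Continuous β) (hd : Integrable (damping β ω)) (x : ℝ) :
    Integrable fun y : ℝ => damping β ω y * Complex.exp (Complex.I * x * y) :=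
  hd.congr' ((continuous_damping hβ).mul (by fun_prop)).aestronglyMeasurable
    (Eventually.of_forall fun y => by rw [norm_mul, norm_cexp_I_mul, mul_one])

theorem norm_fFun_le (x : ℝ) :
    ‖fFun β ω x‖ ≤ 1 / (2 * Real.pi) * ∫ y : ℝ, Real.exp (-(ω : ℕ) * β y) := by
  rw [fFun_eq, norm_mul]
  have : ‖(1 / (2 * Real.pi) : ℂ)‖ = 1 / (2 * Real.pi) := by
    simp [abs_of_pos Real.pi_pos]
  rw [this]
  refine mul_le_mul_of_nonneg_left ((norm_integral_le_integral_norm _).trans_eq ?_) (by positivity)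
  refine integral_congr_ae (Eventually.of_forall fun y => ?_)
  simp only [norm_mul, norm_cexp_I_mul, mul_one, norm_damping]

theorem continuous_fFun (hβ : Continuous β) (hd : Integrable (damping β ω)) :
    Continuous (fFun β ω) := by
  refine continuous_const.mul (continuous_of_dominated (bound := fun y => ‖damping β ω y‖)
    (fun x => (integrable_damping_mul hβ hd x).aestronglyMeasurable)
    (fun x => Eventually.of_forall fun y => ?_) hd.norm
    (Eventually.of_forall fun y => by fun_prop))
  change ‖damping β ω y * _‖ ≤ _
  rw [norm_mul, norm_cexp_I_mul, mul_one]

theorem fFun_mem (hβ : Continuous β) (h : ∫ x : ℝ, ‖fFun β ω x‖ = 1) : fFun β ω ∈ PCFun := by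
  have hc := continuous_fFun hβ (integrable_damping hβ h)
  refine ⟨⟨_, norm_fFun_le⟩, ?_, hc.continuousOn, hc.continuousOn⟩
  rw [← integrable_norm_iff hc.aestronglyMeasurable]
  -- A non-integrable norm would have integral 0 by convention, against the value 1.
  by_contra hi
  rw [integral_undef hi] at h
  exact zero_ne_one h

theorem fFun_neg (heven : ∀ y, β (-y) = β y) (x : ℝ) : fFun β ω (-x) = fFun β ω x := by
  rw [fFun_eq, fFun_eq, ← integral_neg_eq_self]
  simp [damping, heven]

theorem conj_fFun (heven : ∀ y, β (-y) = β y) (x : ℝ) :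
    starRingEnd ℂ (fFun β ω x) = fFun β ω x := by
  refine Eq.trans ?_ (fFun_neg heven x)
  rw [fFun_eq, fFun_eq, map_mul, ← integral_conj]
  simp [damping, ← Complex.exp_conj, map_ofNat]

theorem fFun_eq_fourierInv (x : ℝ) :
    fFun β ω (2 * Real.pi * x) = 1 / (2 * Real.pi) * 𝓕⁻ (damping β ω) x := by
  rw [fFun_eq, Real.fourierInv_eq']
  congr 2
  ext y
  rw [smul_eq_mul, mul_comm]
  congr 2
  simp
  ring

/-- Fourier inversion applies because the multiplier is continuous and integrable and its transform,
a rescaled f_ω, is integrable. The substitution by 2π passes between the two normalizations. -/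
theorem integral_fFun_mul (hβ : Continuous β) (h : ∫ x : ℝ, ‖fFun β ω x‖ = 1) (y : ℝ) :
    ∫ x : ℝ, fFun β ω x * Complex.exp (-(Complex.I * x * y)) = damping β ω y := by
  have hpi : (2 * Real.pi : ℂ) ≠ 0 := by simp [Real.pi_ne_zero]
  have hF : 𝓕⁻ (damping β ω) = fun x => 2 * Real.pi * fFun β ω (2 * Real.pi * x) := by
    ext x
    rw [fFun_eq_fourierInv]
    field_simp
  have hi : Integrable (𝓕 (damping β ω)) := by
    have h1 : 𝓕 (damping β ω) = fun x => 𝓕⁻ (damping β ω) (-x) := by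
      ext x
      rw [Real.fourierInv_eq_fourier_neg, neg_neg]
    rw [h1, hF]
    exact (((fFun_mem hβ h).2.1.comp_mul_left' (by positivity)).const_mul _).comp_neg
  have := congrFun ((continuous_damping hβ).fourier_fourierInv_eq (integrable_damping hβ h) hi) y
  rw [← this, hF, Real.fourier_real_eq_integral_exp_smul]
  have h2 := Measure.integral_comp_mul_left
    (fun x : ℝ => fFun β ω x * Complex.exp (-(Complex.I * x * y))) (2 * Real.pi)
  rw [abs_of_pos (by positivity), eq_comm, inv_smul_eq_iff₀ (by positivity)] at h2
  rw [h2, ← integral_smul]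
  refine integral_congr_ae (Eventually.of_forall fun x => ?_)
  simp only [Complex.real_smul, smul_eq_mul]
  push_cast
  have : -(Complex.I * (2 * Real.pi * x) * y) = -2 * Real.pi * x * y * Complex.I := by ring
  rw [this]
  ring

/-- Expand f_ω' as an integral over frequencies y and integrate over t first: this produces the
Fourier transform of f_ω at y, and the two multipliers combine to exp(-(ω+ω')β). -/
theorem conv_fFun (hβ : Continuous β) (hnorm : ∀ ω : ℕ+, ∫ x : ℝ, ‖fFun β ω x‖ = 1) (ω ω' : ℕ+) :
    conv (fFun β ω) (fFun β ω') = fFun β (ω + ω') := by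
  ext x
  have hi : Integrable (Function.uncurry fun t y : ℝ =>
      fFun β ω t * (damping β ω' y * Complex.exp (Complex.I * (x - t : ℝ) * y))) := by
    have h1 := (fFun_mem hβ (hnorm ω)).2.1.mul_prod (integrable_damping hβ (hnorm ω'))
    refine h1.congr' (Continuous.aestronglyMeasurable ?_) (Eventually.of_forall fun z => ?_)
    · have := continuous_fFun hβ (integrable_damping hβ (hnorm ω))
      have := continuous_damping (ω := ω') hβ
      unfold Function.uncurry
      fun_prop
    · simp only [Function.uncurry, norm_mul, norm_cexp_I_mul, mul_one]
  calc conv (fFun β ω) (fFun β ω') x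
      = 1 / (2 * Real.pi) * ∫ t : ℝ, ∫ y : ℝ,
          fFun β ω t * (damping β ω' y * Complex.exp (Complex.I * (x - t : ℝ) * y)) := by
        rw [conv, ← integral_const_mul]
        refine integral_congr_ae (Eventually.of_forall fun t => ?_)
        simp only [fFun_eq (ω := ω'), integral_const_mul]
        ring
    _ = 1 / (2 * Real.pi) * ∫ y : ℝ, ∫ t : ℝ,
          fFun β ω t * (damping β ω' y * Complex.exp (Complex.I * (x - t : ℝ) * y)) := by
        rw [integral_integral_swap hi]
    _ = fFun β (ω + ω') x := by
        rw [fFun_eq]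
        congr 2
        ext y
        rw [← damping_mul, ← integral_fFun_mul hβ (hnorm ω), ← integral_mul_const,
          ← integral_mul_const]
        congr 1
        ext t
        have : Complex.exp (Complex.I * (x - t : ℝ) * y) =
            Complex.exp (-(Complex.I * t * y)) * Complex.exp (Complex.I * x * y) := by
          rw [← Complex.exp_add]
          congr 1
          push_cast
          ring
        rw [this]
        ring

theorem convPow_fFun (hβ : Continuous β) (hnorm : ∀ ω : ℕ+, ∫ x : ℝ, ‖fFun β ω x‖ = 1) (n : ℕ) :
    convPow (fFun β 1) n = fFun β n.succPNat := by
  induction n with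
  | zero => rfl
  | succ n ih =>
    rw [convPow, ih, conv_fFun hβ hnorm]
    rfl

end Averages

namespace Averages

open PCFun Filter Topology ConvAlg

/-! ### Iterated integrals over partial sums -/

/-- `wordIntegrand` with all the partial sums shifted by `t`. -/
noncomputable def shiftedIntegrand (β : ℝ → ℝ) (S : Set ℝ) (w : List ℕ+) (t : ℝ)
    (x : Fin w.length → ℝ) : ℂ :=
  (∏ i, fFun β (w.get i) (x i)) *
    ∏ i, S.indicator (fun _ => (1 : ℂ)) (t + ∑ j ∈ Finset.Iic i, x j)

/-- The integral of `shiftedIntegrand`, computed one variable at a time. -/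
noncomputable def iterIntegral (β : ℝ → ℝ) (S : Set ℝ) : List ℕ+ → ℝ → ℂ
  | [] => fun _ => 1
  | ω :: w => fun t => ∫ x, fFun β ω x * S.indicator (iterIntegral β S w) (t + x)

variable {β : ℝ → ℝ} {S : Set ℝ}

theorem shiftedIntegrand_zero (w : List ℕ+) :
    shiftedIntegrand β S w 0 = wordIntegrand β S w := by
  ext x
  simp [shiftedIntegrand, wordIntegrand]

theorem sum_Iic_succ_cons {n : ℕ} (x₀ : ℝ) (x : Fin n → ℝ) (i : Fin n) :
    ∑ j ∈ Finset.Iic i.succ, (Fin.cons x₀ x : Fin (n + 1) → ℝ) j =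
      x₀ + ∑ j ∈ Finset.Iic i, x j := by
  have h : ∀ {m : ℕ} (y : Fin m → ℝ) (k : Fin m),
      ∑ j ∈ Finset.Iic k, y j = ∑ j, if j ≤ k then y j else 0 := by
    intro m y k
    rw [← Finset.sum_filter]
    congr 1
    ext j
    simp
  rw [h, h, Fin.sum_univ_succ]
  simp

theorem shiftedIntegrand_cons (ω : ℕ+) (w : List ℕ+) (t x₀ : ℝ) (x : Fin w.length → ℝ) :
    shiftedIntegrand β S (ω :: w) t (Fin.cons x₀ x : Fin (w.length + 1) → ℝ) =
      fFun β ω x₀ * S.indicator (fun s => shiftedIntegrand β S w s x) (t + x₀) := by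
  have h0 : ∑ j ∈ Finset.Iic (0 : Fin (w.length + 1)),
      (Fin.cons x₀ x : Fin (w.length + 1) → ℝ) j = x₀ := by
    have : Finset.Iic (0 : Fin (w.length + 1)) = {0} := by ext j; simp
    rw [this]
    simp
  have h1 : shiftedIntegrand β S (ω :: w) t (Fin.cons x₀ x : Fin (w.length + 1) → ℝ) =
      (∏ i : Fin (w.length + 1), fFun β ((ω :: w).get i)
        ((Fin.cons x₀ x : Fin (w.length + 1) → ℝ) i)) *
      ∏ i : Fin (w.length + 1), S.indicator (fun _ => (1 : ℂ))
        (t + ∑ j ∈ Finset.Iic i, (Fin.cons x₀ x : Fin (w.length + 1) → ℝ) j) := rfl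
  rw [h1, Fin.prod_univ_succ, Fin.prod_univ_succ, h0]
  simp only [sum_Iic_succ_cons, Fin.cons_zero, Fin.cons_succ, List.get_cons_zero,
    List.get_cons_succ', ← add_assoc t]
  by_cases h : t + x₀ ∈ S
  · rw [indicator_of_mem h, indicator_of_mem h, shiftedIntegrand]
    ring
  · rw [indicator_of_notMem h, indicator_of_notMem h]
    ring

theorem integrable_shiftedIntegrand (hS : MeasurableSet S)
    (hf : ∀ ω : ℕ+, Integrable (fFun β ω)) (w : List ℕ+) (t : ℝ) :
    Integrable (shiftedIntegrand β S w t) := by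
  have h1 : Integrable fun x : Fin w.length → ℝ => ∏ i, fFun β (w.get i) (x i) :=
    Integrable.fintype_prod fun i => hf (w.get i)
  refine h1.mul_bdd (c := 1) (Measurable.aestronglyMeasurable ?_) (Eventually.of_forall fun x => ?_)
  · refine Finset.measurable_prod _ fun i _ => (measurable_const.indicator hS).comp ?_
    fun_prop
  · rw [norm_prod]
    refine Finset.prod_le_one (fun i _ => norm_nonneg _) fun i _ => ?_
    exact (norm_indicator_le_norm_self _ _).trans (by simp)

/-- Fubini in the first variable, whose value is then added to the shift of all later partial sums.
For the empty word the domain is a point of volume 1. -/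
theorem integral_shiftedIntegrand (hS : MeasurableSet S)
    (hf : ∀ ω : ℕ+, Integrable (fFun β ω)) (w : List ℕ+) (t : ℝ) :
    ∫ x, shiftedIntegrand β S w t x = iterIntegral β S w t := by
  induction w generalizing t with
  | nil =>
    have h : shiftedIntegrand β S [] t = fun _ => 1 := by
      ext x
      simp [shiftedIntegrand]
    have hv : (volume : Measure (Fin ([] : List ℕ+).length → ℝ)) univ = 1 := by
      rw [← pi_univ univ, volume_pi_pi]
      simp
    rw [h, iterIntegral, integral_const, Measure.real, hv]
    simp
  | cons ω w ih =>
    have e := (volume_preserving_piFinSuccAbove (fun _ : Fin (w.length + 1) => ℝ) 0).symm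
    have he : ∀ p : ℝ × (Fin w.length → ℝ),
        (MeasurableEquiv.piFinSuccAbove (fun _ : Fin (w.length + 1) => ℝ) 0).symm p =
          (Fin.cons p.1 p.2 : Fin (w.length + 1) → ℝ) := by
      intro p
      simp [MeasurableEquiv.piFinSuccAbove]
      rfl
    have hi := (e.integrable_comp_emb (MeasurableEquiv.measurableEmbedding _)).2
      (integrable_shiftedIntegrand hS hf (ω :: w) t)
    have hc := e.integral_comp' (g := shiftedIntegrand β S (ω :: w) t)
    refine hc.symm.trans ?_
    simp only [Function.comp_def, he, shiftedIntegrand_cons] at hi ⊢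
    rw [Measure.volume_eq_prod] at hi ⊢
    rw [integral_prod _ hi, iterIntegral]
    refine integral_congr_ae (Eventually.of_forall fun x₀ => ?_)
    simp only [integral_const_mul]
    congr 1
    by_cases h : t + x₀ ∈ S
    · simp only [indicator_of_mem h, ih]
    · simp only [indicator_of_notMem h, integral_zero]

theorem norm_iterIntegral_le (hf : ∀ ω : ℕ+, Integrable (fFun β ω))
    (hnorm : ∀ ω : ℕ+, ∫ x : ℝ, ‖fFun β ω x‖ = 1) (w : List ℕ+) (t : ℝ) :
    ‖iterIntegral β S w t‖ ≤ 1 := by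
  induction w generalizing t with
  | nil => simp [iterIntegral]
  | cons ω w ih =>
    rw [← hnorm ω, iterIntegral]
    refine norm_integral_le_of_norm_le (hf ω).norm (Eventually.of_forall fun x => ?_)
    rw [norm_mul]
    exact mul_le_of_le_one_right (norm_nonneg _) ((norm_indicator_le_norm_self _ _).trans (ih _))

theorem stronglyMeasurable_iterIntegral (hS : MeasurableSet S)
    (hf : ∀ ω : ℕ+, StronglyMeasurable (fFun β ω)) (w : List ℕ+) :
    StronglyMeasurable (iterIntegral β S w) := by
  induction w with
  | nil => exact stronglyMeasurable_const
  | cons ω w ih =>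
    have h : StronglyMeasurable (Function.uncurry fun t x : ℝ =>
        fFun β ω x * S.indicator (iterIntegral β S w) (t + x)) :=
      ((hf ω).comp_measurable measurable_snd).mul
        ((ih.indicator hS).comp_measurable (measurable_fst.add measurable_snd))
    exact h.integral_prod_right

/-- Transposition of convolution by g against a bounded test function: Fubini and the translation u
= s + x. -/
theorem integral_conv_mul {f g G : ℝ → ℂ} (hf : Integrable f) (hg : Integrable g)
    (hG : StronglyMeasurable G) {C : ℝ} (hC : ∀ x, ‖G x‖ ≤ C) :
    ∫ u, conv f g u * G u = ∫ s, f s * ∫ x, g x * G (s + x) := by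
  have hi : Integrable (Function.uncurry fun u s : ℝ => f s * g (u - s) * G u) := by
    have := hf.convolution_integrand (ContinuousLinearMap.mul ℝ ℂ) hg (μ := volume) (ν := volume)
    exact this.mul_bdd (c := C) (hG.comp_measurable measurable_fst).aestronglyMeasurable
      (Eventually.of_forall fun p => hC _)
  simp only [conv, ← integral_mul_const]
  rw [integral_integral_swap hi]
  refine integral_congr_ae (Eventually.of_forall fun s => ?_)
  simp only [← integral_const_mul]
  rw [← integral_add_left_eq_self _ s]
  simp [mul_assoc]

/-- Each letter is moved by transposition from the convolved function to the test function, which is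
1 at the start. -/
theorem integral_iterConv (hβ : Continuous β) (hnorm : ∀ ω : ℕ+, ∫ x : ℝ, ‖fFun β ω x‖ = 1)
    (hS : MeasurableSet S) (w : List ℕ+) {h : ℝ → ℂ} (hh : Integrable h) :
    ∫ x, iterConv S (fFun β 1) h w x = ∫ x, h x * iterIntegral β S w x := by
  have hf : ∀ ω : ℕ+, Integrable (fFun β ω) := fun ω => (fFun_mem hβ (hnorm ω)).2.1
  have hm : ∀ ω : ℕ+, StronglyMeasurable (fFun β ω) := fun ω =>
    (continuous_fFun hβ (integrable_damping hβ (hnorm ω))).stronglyMeasurable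
  induction w generalizing h with
  | nil => simp [iterConv, iterIntegral]
  | cons ω w ih =>
    have hp : convPow (fFun β 1) ((ω : ℕ) - 1) = fFun β ω := by
      rw [convPow_fFun hβ hnorm]
      congr 1
      exact PNat.succPNat_natPred ω
    have hc : Integrable (conv h (fFun β ω)) := by
      rw [conv_eq]
      exact hh.integrable_convolution _ (hf ω)
    rw [iterConv, hp, ih (hc.indicator hS)]
    simp only [iterIntegral]
    rw [← integral_conv_mul hh (hf ω) ((stronglyMeasurable_iterIntegral hS hm w).indicator hS)
      (C := 1) fun x => (norm_indicator_le_norm_self _ _).trans (norm_iterIntegral_le hf hnorm w x)]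
    refine integral_congr_ae (Eventually.of_forall fun x => ?_)
    by_cases hx : x ∈ S <;> simp [hx]

theorem integral_iterConv_eq_integral_wordIntegrand (hβ : Continuous β)
    (hnorm : ∀ ω : ℕ+, ∫ x : ℝ, ‖fFun β ω x‖ = 1) (hS : MeasurableSet S) (ω : ℕ+) (w : List ℕ+) :
    ∫ x, iterConv S (fFun β 1) (S.indicator (convPow (fFun β 1) ((ω : ℕ) - 1))) w x =
      ∫ x, wordIntegrand β S (ω :: w) x := by
  have hf : ∀ ω : ℕ+, Integrable (fFun β ω) := fun ω => (fFun_mem hβ (hnorm ω)).2.1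
  have hp : convPow (fFun β 1) ((ω : ℕ) - 1) = fFun β ω := by
    rw [convPow_fFun hβ hnorm]
    congr 1
    exact PNat.succPNat_natPred ω
  rw [hp, integral_iterConv hβ hnorm hS w ((hf ω).indicator hS), ← shiftedIntegrand_zero,
    integral_shiftedIntegrand hS hf, iterIntegral]
  refine integral_congr_ae (Eventually.of_forall fun x => ?_)
  by_cases hx : x ∈ S <;> simp [hx]

theorem iterIntegral_Iic_neg (heven : ∀ y, β (-y) = β y) (w : List ℕ+) (t : ℝ) :
    iterIntegral β (Iic 0) w (-t) = iterIntegral β (Ioi 0) w t := by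
  induction w generalizing t with
  | nil => rfl
  | cons ω w ih =>
    simp only [iterIntegral]
    rw [← integral_neg_eq_self]
    -- Reflection sends (0, ∞) to (-∞, 0), not to (-∞, 0]; the missing endpoint is the null set x =
    -- -t.
    have hne : ∀ᵐ x : ℝ, x ≠ -t := by simp [ae_iff]
    refine integral_congr_ae ?_
    filter_upwards [hne] with x hx
    rw [fFun_neg heven, ← neg_add]
    congr 1
    by_cases h : 0 < t + x
    · rw [indicator_of_mem (mem_Iic.2 (neg_nonpos.2 h.le)), indicator_of_mem (mem_Ioi.2 h), ih]
    · have : t + x ≠ 0 := fun h' => hx (by linarith)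
      have : t + x < 0 := lt_of_le_of_ne (not_lt.1 h) this
      rw [indicator_of_notMem (fun h' => (neg_pos.2 this).not_ge (mem_Iic.1 h')),
        indicator_of_notMem (fun h' => h (mem_Ioi.1 h'))]

theorem conj_wordIntegrand (heven : ∀ y, β (-y) = β y) (w : List ℕ+) (x : Fin w.length → ℝ) :
    starRingEnd ℂ (wordIntegrand β S w x) = wordIntegrand β S w x := by
  rw [wordIntegrand, map_mul, map_prod, map_prod]
  simp only [conj_fFun heven]
  congr 1
  refine Finset.prod_congr rfl fun i _ => ?_
  simp only [indicator]
  split_ifs <;> simp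

theorem conj_integral_wordIntegrand (heven : ∀ y, β (-y) = β y) (w : List ℕ+) :
    starRingEnd ℂ (∫ x, wordIntegrand β S w x) = ∫ x, wordIntegrand β S w x := by
  rw [← integral_conj]
  simp only [conj_wordIntegrand heven]

theorem integral_wordIntegrand_Iic (heven : ∀ y, β (-y) = β y)
    (hf : ∀ ω : ℕ+, Integrable (fFun β ω)) (w : List ℕ+) :
    ∫ x, wordIntegrand β (Iic 0) w x = ∫ x, wordIntegrand β (Ioi 0) w x := by
  rw [← shiftedIntegrand_zero, ← shiftedIntegrand_zero,
    integral_shiftedIntegrand measurableSet_Iic hf, integral_shiftedIntegrand measurableSet_Ioi hf,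
    ← iterIntegral_Iic_neg heven, neg_zero]

/-! ### Iterated projections as iterated convolutions -/

theorem exists_pow_eq_inr (γ : PCFun) (n : ℕ) :
    ∃ g : PCFun, (γ : ConvAlg) ^ (n + 1) = (g : ConvAlg) ∧ (g : ℝ → ℂ) = convPow γ n := by
  induction n with
  | zero => exact ⟨γ, by simp, rfl⟩
  | succ n ih =>
    obtain ⟨g, hg, hg'⟩ := ih
    refine ⟨g * γ, ?_, ?_⟩
    · rw [pow_succ, hg, Unitization.inr_mul]
    · rw [coe_mul, hg', convPow]

theorem Θ_inr (f : PCFun) : Θ (f : ConvAlg) = ∫ x, (f : ℝ → ℂ) x := by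
  simp [Θ, integralHom]

section

variable {P : ConvAlg →ₗ[ℂ] ConvAlg} {p : PCFun → PCFun}

/-- Functions form an ideal, so a computation that starts from a function never meets δ. The full
iterate starts from δ, hence its first letter is treated separately in `Θ_iterProj`. -/
theorem exists_foldl_eq_inr (hP : ∀ f : PCFun, P (f : ConvAlg) = (p f : ConvAlg))
    (hp : ∀ f : PCFun, (p f : ℝ → ℂ) = S.indicator f) (γ : PCFun) (w : List ℕ+) (h : PCFun) :
    ∃ k : PCFun, w.foldl (fun x (ω : ℕ+) => P (x * (γ : ConvAlg) ^ (ω : ℕ))) (h : ConvAlg) =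
      (k : ConvAlg) ∧ (k : ℝ → ℂ) = iterConv S γ h w := by
  induction w generalizing h with
  | nil => exact ⟨h, rfl, rfl⟩
  | cons ω w ih =>
    obtain ⟨g, hg, hg'⟩ := exists_pow_eq_inr γ ((ω : ℕ) - 1)
    rw [Nat.sub_add_cancel ω.pos] at hg
    obtain ⟨k, hk, hk'⟩ := ih (p (h * g))
    refine ⟨k, ?_, ?_⟩
    · rw [List.foldl_cons, hg, ← Unitization.inr_mul, hP, hk]
    · rw [hk', hp, coe_mul, hg', iterConv]

theorem Θ_iterProj (hP : ∀ f : PCFun, P (f : ConvAlg) = (p f : ConvAlg))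
    (hp : ∀ f : PCFun, (p f : ℝ → ℂ) = S.indicator f) (γ : PCFun) (ω : ℕ+) (w : List ℕ+) :
    Θ (iterProj P (γ : ConvAlg) (ω :: w)) =
      ∫ x, iterConv S γ (S.indicator (convPow γ ((ω : ℕ) - 1))) w x := by
  obtain ⟨g, hg, hg'⟩ := exists_pow_eq_inr γ ((ω : ℕ) - 1)
  rw [Nat.sub_add_cancel ω.pos] at hg
  obtain ⟨k, hk, hk'⟩ := exists_foldl_eq_inr hP hp γ w (p g)
  rw [iterProj, List.foldl_cons, one_mul, hg, hP, hk, Θ_inr, hk', hp, hg']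

end

theorem R_inr (f : PCFun) : R (f : ConvAlg) = (cut f : ConvAlg) := by
  rw [R_apply, Unitization.snd_inr]

theorem Rtilde_inr (f : PCFun) : Rtilde (f : ConvAlg) = ((f - cut f : PCFun) : ConvAlg) := by
  rw [Rtilde_apply, R_inr, ← Unitization.inr_sub]

theorem Θ_iterProj_R (γ : PCFun) (ω : ℕ+) (w : List ℕ+) :
    Θ (iterProj R (γ : ConvAlg) (ω :: w)) =
      ∫ x, iterConv (Ioi 0) γ ((Ioi 0).indicator (convPow γ ((ω : ℕ) - 1))) w x :=
  Θ_iterProj R_inr cut_apply γ ω w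

theorem Θ_iterProj_Rtilde (γ : PCFun) (ω : ℕ+) (w : List ℕ+) :
    Θ (iterProj Rtilde (γ : ConvAlg) (ω :: w)) =
      ∫ x, iterConv (Iic 0) γ ((Iic 0).indicator (convPow γ ((ω : ℕ) - 1))) w x :=
  Θ_iterProj Rtilde_inr coe_sub_cut γ ω w

end Averages

namespace Averages

open PCFun Filter Topology FourierTransform

/-! ### The multiplier at the origin -/

/-- The mass of a convolution outside `[-(a + b), a + b]`, in terms of the masses of the factors
inside `[-a, a]` and `[-b, b]`. -/
theorem setIntegral_compl_norm_conv_le {u v : ℝ → ℂ} (hu : u ∈ PCFun) (hv : v ∈ PCFun) (a b : ℝ) :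
    ∫ x in (Icc (-(a + b)) (a + b))ᶜ, ‖conv u v x‖ ≤
      (∫ x, ‖u x‖) * (∫ x, ‖v x‖) -
        (∫ x in Icc (-a) a, ‖u x‖) * ∫ x in Icc (-b) b, ‖v x‖ := by
  set u' : ℝ → ℝ := (Icc (-a) a).indicator fun x => ‖u x‖
  set v' : ℝ → ℝ := (Icc (-b) b).indicator fun x => ‖v x‖
  have hui : Integrable fun x => ‖u x‖ := hu.2.1.norm
  have hvi : Integrable fun x => ‖v x‖ := hv.2.1.norm
  have hui' : Integrable u' := hui.indicator measurableSet_Icc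
  have hvi' : Integrable v' := hvi.indicator measurableSet_Icc
  have hu0 : ∀ x, 0 ≤ u' x := fun x => indicator_nonneg (fun _ _ => norm_nonneg _) x
  have hv0 : ∀ x, 0 ≤ v' x := fun x => indicator_nonneg (fun _ _ => norm_nonneg _) x
  have hule : ∀ x, u' x ≤ ‖u x‖ := fun x => indicator_le_self' (fun _ _ => norm_nonneg _) x
  have hvle : ∀ x, v' x ≤ ‖v x‖ := fun x => indicator_le_self' (fun _ _ => norm_nonneg _) x
  set L := ContinuousLinearMap.mul ℝ ℝ
  have h1 := integral_convolution L hui hvi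
  have h2 := integral_convolution L hui' hvi'
  have i1 := hui.integrable_convolution L hvi
  have i2 := hui'.integrable_convolution L hvi'
  have iw : Integrable (conv u v) := (conv_mem hu hv).2.1
  rw [← integral_indicator measurableSet_Icc, ← integral_indicator measurableSet_Icc]
  change _ ≤ L (∫ x, ‖u x‖) (∫ x, ‖v x‖) - L (∫ x, u' x) (∫ x, v' x)
  rw [← h1, ← h2, ← integral_sub i1 i2, ← integral_indicator measurableSet_Icc.compl]
  refine integral_mono (iw.norm.indicator measurableSet_Icc.compl) (i1.sub i2) fun x => ?_
  have hx1 : Integrable fun t => ‖u t‖ * ‖v (x - t)‖ := by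
    simpa using (integrable_conv hu hv x).norm
  by_cases hx : x ∈ Icc (-(a + b)) (a + b)
  · rw [indicator_of_notMem (by simpa using hx), sub_nonneg]
    refine integral_mono_of_nonneg (Eventually.of_forall fun t => mul_nonneg (hu0 _) (hv0 _)) hx1
      (Eventually.of_forall fun t => ?_)
    exact mul_le_mul (hule _) (hvle _) (hv0 _) (norm_nonneg _)
  · rw [indicator_of_mem hx]
    -- The truncated factors are supported in [-a, a] and [-b, b], so their convolution vanishes
    -- outside the sum of these intervals.
    have h0 : (u' ⋆[L] v') x = 0 := by
      refine integral_eq_zero_of_ae (Eventually.of_forall fun t => ?_)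
      change u' t * v' (x - t) = 0
      by_cases ht : t ∈ Icc (-a) a
      · have : x - t ∉ Icc (-b) b := fun h =>
          hx ⟨by linarith [ht.1, h.1], by linarith [ht.2, h.2]⟩
        simp only [v', indicator_of_notMem this, mul_zero]
      · simp only [u', indicator_of_notMem ht, zero_mul]
    rw [h0, sub_zero]
    refine (norm_integral_le_integral_norm _).trans_eq ?_
    simp only [norm_mul]
    rfl

variable {β : ℝ → ℝ}

theorem pow_le_setIntegral_norm_fFun (hβ : Continuous β)
    (hnorm : ∀ ω : ℕ+, ∫ x : ℝ, ‖fFun β ω x‖ = 1) (a : ℝ) (n : ℕ) :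
    (∫ x in Icc (-a) a, ‖fFun β 1 x‖) ^ (n + 1) ≤
      ∫ x in Icc (-((n + 1) * a)) ((n + 1) * a), ‖fFun β n.succPNat x‖ := by
  induction n with
  | zero => simp; rfl
  | succ n ih =>
    have hc : conv (fFun β n.succPNat) (fFun β 1) = fFun β (n + 1).succPNat :=
      conv_fFun hβ hnorm _ _
    have hm := fFun_mem hβ (hnorm n.succPNat)
    have hm1 := fFun_mem hβ (hnorm 1)
    have h := setIntegral_compl_norm_conv_le hm hm1 ((n + 1) * a) a
    have hs := integral_add_compl (s := Icc (-((n + 1) * a + a)) ((n + 1) * a + a))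
      measurableSet_Icc (conv_mem hm hm1).2.1.norm
    rw [hc, hnorm, hnorm, one_mul] at h
    rw [hc, hnorm] at hs
    have he : (((n + 1 : ℕ) : ℝ) + 1) * a = (n + 1) * a + a := by push_cast; ring
    rw [he, pow_succ]
    have h0 : 0 ≤ ∫ x in Icc (-a) a, ‖fFun β 1 x‖ := integral_nonneg fun x => norm_nonneg _
    nlinarith [mul_le_mul_of_nonneg_right ih h0]

/-- Riemann–Lebesgue: exp(-β) is the Fourier transform of the integrable f₁, up to scaling. Hence β
tends to infinity and attains its minimum. -/
theorem tendsto_damping_cocompact (hβ : Continuous β) (h : ∫ x : ℝ, ‖fFun β 1 x‖ = 1) :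
    Tendsto (damping β 1) (cocompact ℝ) (𝓝 0) := by
  have h1 : damping β 1 = fun y => 𝓕 (fFun β 1) ((2 * Real.pi)⁻¹ * y) := by
    ext y
    rw [← integral_fFun_mul hβ h, Real.fourier_real_eq_integral_exp_smul]
    refine integral_congr_ae (Eventually.of_forall fun x => ?_)
    simp only [smul_eq_mul]
    have : -2 * Real.pi * x * ((2 * Real.pi)⁻¹ * y) = -(x * y) := by
      have := Real.pi_ne_zero
      field_simp
    rw [this, mul_comm]
    congr 2
    push_cast
    ring
  rw [h1]
  exact (Real.zero_at_infty_fourier _).comp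
    (tendsto_cocompact_mul_left₀ (inv_ne_zero (by positivity)))

theorem exists_forall_le (hβ : Continuous β) (h : ∫ x : ℝ, ‖fFun β 1 x‖ = 1) :
    ∃ y₀, ∀ y, β y₀ ≤ β y := by
  refine hβ.exists_forall_le ?_
  have h1 := (tendsto_damping_cocompact hβ h).norm
  simp only [norm_damping, norm_zero, Real.tendsto_exp_comp_nhds_zero] at h1
  exact (tendsto_neg_atBot_atTop.comp h1).congr fun y => by simp

theorem nonneg_of_norm_eq_one (hβ : Continuous β) (h : ∫ x : ℝ, ‖fFun β 1 x‖ = 1) (y : ℝ) :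
    0 ≤ β y := by
  have h1 : ‖damping β 1 y‖ ≤ 1 := by
    rw [← integral_fFun_mul hβ h, ← h]
    refine (norm_integral_le_integral_norm _).trans_eq (integral_congr_ae
      (Eventually.of_forall fun x => ?_))
    simp [Complex.norm_exp]
  rw [norm_damping, Real.exp_le_one_iff] at h1
  simpa using h1

/-- If β ≥ m > 0, then f_(n+1) is bounded by a multiple of r^n with r = exp(-m) < 1. Yet its mass on
an interval of length 2(n+1)a is at least s^(n+1), where s is the mass of f₁ on [-a, a]. Choosing a
with s > r makes the two incompatible for large n. -/
theorem lowerBound_nonpos (hβ : Continuous β) (hnorm : ∀ ω : ℕ+, ∫ x : ℝ, ‖fFun β ω x‖ = 1) {m : ℝ}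
    (hm : ∀ y, m ≤ β y) : m ≤ 0 := by
  by_contra! hpos
  set r := Real.exp (-m)
  have hr1 : r < 1 := by simpa [r] using hpos
  have hr0 : 0 < r := Real.exp_pos _
  set C := 1 / (2 * Real.pi) * ∫ y : ℝ, Real.exp (-β y)
  have hexp : Integrable fun y => Real.exp (-β y) := by
    simpa [norm_damping] using (integrable_damping hβ (hnorm 1)).norm
  have hbound : ∀ (n : ℕ) x, ‖fFun β n.succPNat x‖ ≤ C * r ^ n := by
    intro n x
    refine (norm_fFun_le x).trans ?_
    rw [mul_assoc, ← integral_mul_const]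
    refine mul_le_mul_of_nonneg_left (integral_mono_of_nonneg
      (Eventually.of_forall fun y => (Real.exp_pos _).le) (hexp.mul_const _)
      (Eventually.of_forall fun y => ?_)) (by positivity)
    simp only [r, ← Real.exp_nat_mul, ← Real.exp_add, Real.exp_le_exp, Nat.succPNat_coe]
    push_cast
    nlinarith [hm y, (Nat.cast_nonneg n : (0 : ℝ) ≤ n)]
  obtain ⟨a, ha0, ha⟩ : ∃ a : ℝ, 0 < a ∧ r < ∫ x in Icc (-a) a, ‖fFun β 1 x‖ := by
    have ht := (aecover_Icc (μ := (volume : Measure ℝ)) tendsto_neg_atTop_atBot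
      tendsto_id).integral_tendsto_of_countably_generated (fFun_mem hβ (hnorm 1)).2.1.norm
    rw [hnorm] at ht
    exact ((eventually_gt_atTop 0).and (ht.eventually_const_lt hr1)).exists
  set s := ∫ x in Icc (-a) a, ‖fFun β 1 x‖
  have hs0 : 0 < s := hr0.trans ha
  have key : ∀ n : ℕ, s ≤ 2 * a * C * ((n + 1) * (r / s) ^ n) := by
    intro n
    have h1 := pow_le_setIntegral_norm_fFun hβ hnorm a n
    have h2 : ∫ x in Icc (-((n + 1) * a)) ((n + 1) * a), ‖fFun β n.succPNat x‖ ≤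
        C * r ^ n * (2 * ((n + 1) * a)) := by
      have hv : volume.real (Icc (-((n + 1) * a)) ((n + 1) * a)) = 2 * ((n + 1) * a) := by
        rw [Real.volume_real_Icc_of_le (by
          nlinarith [mul_pos (Nat.cast_add_one_pos n : (0 : ℝ) < n + 1) ha0])]
        ring
      rw [← hv]
      refine (Real.le_norm_self _).trans (norm_setIntegral_le_of_norm_le_const ?_ fun x _ => ?_)
      · exact measure_Icc_lt_top
      · rw [norm_norm]
        exact hbound n x
    have h3 := h1.trans h2
    rw [div_pow]
    have hsn : 0 < s ^ n := pow_pos hs0 n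
    rw [← mul_le_mul_iff_left₀ hsn]
    calc s * s ^ n = s ^ (n + 1) := by ring
      _ ≤ C * r ^ n * (2 * ((n + 1) * a)) := h3
      _ = _ := by field_simp
  have hq0 : 0 ≤ r / s := by positivity
  have hq1 : r / s < 1 := (div_lt_one hs0).2 ha
  have hlim : Tendsto (fun n : ℕ => 2 * a * C * (((n : ℝ) + 1) * (r / s) ^ n)) atTop (𝓝 0) := by
    have := ((tendsto_self_mul_const_pow_of_lt_one hq0 hq1).add
      (tendsto_pow_atTop_nhds_zero_of_lt_one hq0 hq1)).const_mul (2 * a * C)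
    simpa [add_mul] using this
  exact hs0.not_ge (ge_of_tendsto' hlim key)

/-- At a minimizer y₀ one has β(y₀) = 0, so ∫ f₁(x) cos(x y₀) dx = 1 = ∫ |f₁|. Equality forces cos(x
y₀) = 1 wherever f₁ > 0, in particular near 0, and so y₀ = 0. -/
theorem beta_zero (hβ : Continuous β) (heven : ∀ y, β (-y) = β y)
    (hnorm : ∀ ω : ℕ+, ∫ x : ℝ, ‖fFun β ω x‖ = 1) : β 0 = 0 := by
  obtain ⟨y₀, hy₀⟩ := exists_forall_le hβ (hnorm 1)
  have hy : β y₀ = 0 := le_antisymm (lowerBound_nonpos hβ hnorm hy₀)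
    (nonneg_of_norm_eq_one hβ (hnorm 1) y₀)
  suffices y₀ = 0 by rwa [this] at hy
  have hc := continuous_fFun hβ (integrable_damping hβ (hnorm 1))
  have hi := (fFun_mem hβ (hnorm 1)).2.1
  set g : ℝ → ℝ := fun x => (fFun β 1 x).re
  have hg : ∀ x, fFun β 1 x = g x := fun x =>
    (Complex.conj_eq_iff_re.1 (conj_fFun heven x)).symm
  have hgc : Continuous g := Complex.continuous_re.comp hc
  have hgi : Integrable g := hi.re
  have hgci : Integrable fun x => g x * Real.cos (x * y₀) :=
    hgi.mul_bdd (c := 1) (by fun_prop) (Eventually.of_forall fun x => Real.abs_cos_le_one _)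
  have hcos : ∫ x, g x * Real.cos (x * y₀) = 1 := by
    have h := congrArg Complex.re (integral_fFun_mul hβ (hnorm 1) y₀)
    have hint : Integrable fun x : ℝ =>
        fFun β 1 x * Complex.exp (-(Complex.I * x * y₀)) :=
      hi.congr' (hc.mul (by fun_prop)).aestronglyMeasurable (Eventually.of_forall fun x => by
        rw [norm_mul, Complex.norm_exp]; simp)
    rw [damping, hy] at h
    have h' := integral_re hint
    simp only [RCLike.re_eq_complex_re] at h'
    rw [← h'] at h
    simpa [hg, Complex.exp_re] using h
  have habs : ∫ x, |g x| = 1 := by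
    rw [← hnorm 1]
    simp only [hg, Complex.norm_real, Real.norm_eq_abs]
  -- A nonnegative continuous function with integral 0 vanishes everywhere, not only almost
  -- everywhere.
  have hzero : (fun x => |g x| - g x * Real.cos (x * y₀)) = 0 := by
    have hnn : ∀ x, 0 ≤ |g x| - g x * Real.cos (x * y₀) := fun x => by
      rw [sub_nonneg]
      refine (le_abs_self _).trans ?_
      rw [abs_mul]
      exact mul_le_of_le_one_right (abs_nonneg _) (Real.abs_cos_le_one _)
    have h := (integral_eq_zero_iff_of_nonneg (μ := volume) hnn (hgi.abs.sub hgci)).1 (by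
      rw [integral_sub hgi.abs hgci, habs, hcos, sub_self])
    exact (Continuous.ae_eq_iff_eq volume (by fun_prop) continuous_const).1 h
  have hg0 : 0 < g 0 := by
    have hexp : Integrable fun y => Real.exp (-β y) := by
      simpa [norm_damping] using (integrable_damping hβ (hnorm 1)).norm
    have : fFun β 1 0 = ((1 / (2 * Real.pi) * ∫ y : ℝ, Real.exp (-β y) : ℝ) : ℂ) := by
      rw [fFun_eq]
      push_cast
      rw [← integral_complex_ofReal]
      simp [damping]
    rw [hg, Complex.ofReal_inj] at this
    rw [this]
    exact mul_pos (by positivity) (integral_exp_pos hexp)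
  have hev : ∀ᶠ x in 𝓝 (0 : ℝ), x * y₀ = 0 := by
    -- Within |x y₀| < 2π the cosine equals 1 only at x y₀ = 0.
    have h1 : ∀ᶠ x in 𝓝 (0 : ℝ), 0 < g x := hgc.continuousAt.eventually_const_lt hg0
    have h2 : ∀ᶠ x in 𝓝 (0 : ℝ), |x * y₀| < 2 * Real.pi :=
      (show ContinuousAt (fun x : ℝ => |x * y₀|) 0 by fun_prop).eventually_lt_const
        (by simp [Real.pi_pos])
    filter_upwards [h1, h2] with x hx1 hx2
    rw [abs_lt] at hx2
    have := congrFun hzero x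
    simp only [abs_of_pos hx1, Pi.zero_apply] at this
    refine (Real.cos_eq_one_iff_of_lt_of_lt hx2.1 hx2.2).1 ?_
    have h3 : g x * (1 - Real.cos (x * y₀)) = 0 := by linarith
    rcases mul_eq_zero.1 h3 with h | h
    · exact absurd h hx1.ne'
    · linarith
  obtain ⟨x, hx, hx0⟩ := ((hev.filter_mono nhdsWithin_le_nhds).and
    (self_mem_nhdsWithin (s := {(0 : ℝ)}ᶜ))).exists
  exact (mul_eq_zero.1 hx).resolve_left hx0

theorem integral_fFun_one (hβ : Continuous β) (heven : ∀ y, β (-y) = β y)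
    (hnorm : ∀ ω : ℕ+, ∫ x : ℝ, ‖fFun β ω x‖ = 1) : ∫ x, fFun β 1 x = 1 := by
  have h := integral_fFun_mul hβ (hnorm 1) 0
  rw [damping, beta_zero hβ heven hnorm] at h
  simpa using h

end Averages

/-! ### Assembly of the algebraic and analytic parts -/

theorem mainTheorem4 (β : ℝ → ℝ) (hβ : AnalyticOnNhd ℝ β Set.univ)
    (heven : ∀ y, β (-y) = β y)
    (hnorm : ∀ ω : ℕ+, ∫ x : ℝ, ‖Averages.fFun β ω x‖ = 1) :
    ∃ γ : PCFun, (γ : ℝ → ℂ) = Averages.fFun β 1 ∧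
    ∃ ψ : Hqsh →ₗ[ℝ] ℂ,
      Averages.SolvesAlgebraicProblem (Averages.phiDiffusion β) ψ ∧
      (∀ h : Hqsh, (Averages.phiDiffusion β h).im = 0) ∧
      (∀ w : List ℕ+,
        Integrable (Averages.wordIntegrand β (Set.Ioi 0) w) ∧
        Integrable (Averages.wordIntegrand β (Set.Iic 0) w)) ∧
      (∀ w : List ℕ+,
        Averages.phiDiffusion β (Hqsh.word w) = (-1) ^ w.length *
          ConvAlg.Θ (Averages.atkinson ConvAlg.R (Averages.letterMap (γ : ConvAlg)) w.length
            (Hqsh.word w))) ∧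
      (∀ (ω : ℕ+) (w : List ℕ+),
        Averages.phiDiffusion β (Hqsh.word (ω :: w)) = (-1) ^ (w.length + 1) *
          ∫ x : ℝ, Averages.iterConv (Set.Ioi 0) γ
            ((Set.Ioi 0).indicator (Averages.convPow γ ((ω : ℕ) - 1))) w x) ∧
      (∀ w : List ℕ+,
        Averages.phiDiffusion β (Hqsh.word w) = (-1) ^ w.length *
          ∫ x : Fin w.length → ℝ, Averages.wordIntegrand β (Set.Ioi 0) w x) ∧
      (∀ w : List ℕ+,
        Averages.convInv ψ (Hqsh.rev (Hqsh.word w)) = (-1) ^ w.length *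
          ConvAlg.Θ (Averages.atkinson ConvAlg.Rtilde (Averages.letterMap (γ : ConvAlg)) w.length
            (Hqsh.word w))) ∧
      (∀ (ω : ℕ+) (w : List ℕ+),
        Averages.convInv ψ (Hqsh.rev (Hqsh.word (ω :: w))) = (-1) ^ (w.length + 1) *
          ∫ x : ℝ, Averages.iterConv (Set.Iic 0) γ
            ((Set.Iic 0).indicator (Averages.convPow γ ((ω : ℕ) - 1))) w x) ∧
      (∀ w : List ℕ+,
        Averages.convInv ψ (Hqsh.rev (Hqsh.word w)) = (-1) ^ w.length *
          ∫ x : Fin w.length → ℝ, Averages.wordIntegrand β (Set.Iic 0) w x) := by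
  have hc : Continuous β := continuousOn_univ.1 hβ.continuousOn
  have hf : ∀ ω : ℕ+, Integrable (Averages.fFun β ω) :=
    fun ω => (Averages.fFun_mem hc (hnorm ω)).2.1
  obtain ⟨γ, hγ⟩ : ∃ γ : PCFun, (γ : ℝ → ℂ) = Averages.fFun β 1 :=
    ⟨⟨_, Averages.fFun_mem hc (hnorm 1)⟩, rfl⟩
  have hΘ : ConvAlg.Θ (γ : ConvAlg) = 1 := by
    rw [Averages.Θ_inr, hγ, Averages.integral_fFun_one hc heven hnorm]
  have hΘ_spitzer : ∀ (P : ConvAlg →ₗ[ℂ] ConvAlg) (w : List ℕ+),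
      ConvAlg.Θ (Averages.spitzer P (γ : ConvAlg) (Hqsh.word w)) =
        (-1) ^ w.length * ConvAlg.Θ (Averages.iterProj P (γ : ConvAlg) w) := by
    intro P w
    rw [Averages.spitzer_word, map_mul, map_pow, map_neg, map_one]
  -- The empty word is separate: its iterate is δ rather than a function, and its integral is over
  -- ℝ⁰.
  have hnil : ∀ {S : Set ℝ}, MeasurableSet S → ∫ x, Averages.wordIntegrand β S [] x = 1 :=
    fun hS => by
      rw [← Averages.shiftedIntegrand_zero, Averages.integral_shiftedIntegrand hS hf]; rfl
  have hR : ∀ w, ConvAlg.Θ (Averages.iterProj ConvAlg.R (γ : ConvAlg) w) =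
      ∫ x, Averages.wordIntegrand β (Set.Ioi 0) w x := by
    rintro (- | ⟨ω, w⟩)
    · rw [hnil measurableSet_Ioi, Averages.iterProj, List.foldl_nil, map_one]
    · rw [Averages.Θ_iterProj_R, hγ,
        Averages.integral_iterConv_eq_integral_wordIntegrand hc hnorm measurableSet_Ioi]
  have hRt : ∀ w, ConvAlg.Θ (Averages.iterProj ConvAlg.Rtilde (γ : ConvAlg) w) =
      ∫ x, Averages.wordIntegrand β (Set.Iic 0) w x := by
    rintro (- | ⟨ω, w⟩)
    · rw [hnil measurableSet_Iic, Averages.iterProj, List.foldl_nil, map_one]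
    · rw [Averages.Θ_iterProj_Rtilde, hγ,
        Averages.integral_iterConv_eq_integral_wordIntegrand hc hnorm measurableSet_Iic]
  have hφ_word : ∀ w, Averages.phiDiffusion β (Hqsh.word w) = (-1) ^ w.length *
      ∫ x : Fin w.length → ℝ, Averages.wordIntegrand β (Set.Ioi 0) w x :=
    Hqsh.extend_word _
  have hφ : Averages.phiDiffusion β = Averages.evalΘ (Averages.spitzer ConvAlg.R (γ : ConvAlg)) :=
    Hqsh.hom_ext fun w => by rw [hφ_word, Averages.evalΘ_apply, hΘ_spitzer, hR]
  refine ⟨γ, hγ, Averages.companion (γ : ConvAlg), ?_, ?_, ?_, ?_, ?_, hφ_word, ?_, ?_, ?_⟩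
  · rw [hφ]
    refine Averages.solvesAlgebraicProblem_companion hΘ fun w => ?_
    rw [hΘ_spitzer, hΘ_spitzer, hR, hRt, map_mul, map_pow, map_neg, map_one,
      Averages.conj_integral_wordIntegrand heven, Averages.integral_wordIntegrand_Iic heven hf]
  · have h : Complex.imLm ∘ₗ Averages.phiDiffusion β = 0 := by
      refine Hqsh.hom_ext fun w => ?_
      rw [LinearMap.comp_apply, hφ_word]
      refine Complex.conj_eq_iff_im.1 ?_
      rw [map_mul, map_pow, map_neg, map_one, Averages.conj_integral_wordIntegrand heven]
    exact fun h' => congrArg (fun F => F h') h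
  · intro w
    rw [← Averages.shiftedIntegrand_zero, ← Averages.shiftedIntegrand_zero]
    exact ⟨Averages.integrable_shiftedIntegrand measurableSet_Ioi hf w 0,
      Averages.integrable_shiftedIntegrand measurableSet_Iic hf w 0⟩
  · intro w
    rw [hφ, Averages.evalΘ_apply, hΘ_spitzer, Averages.atkinson_word]
  · intro ω w
    rw [hφ, Averages.evalΘ_apply, hΘ_spitzer, Averages.Θ_iterProj_R, List.length_cons]
  · intro w
    rw [Averages.convInv_companion_rev hΘ, hΘ_spitzer, Averages.atkinson_word]
  · intro ω w
    rw [Averages.convInv_companion_rev hΘ, hΘ_spitzer, Averages.Θ_iterProj_Rtilde,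
      List.length_cons]
  · intro w
    rw [Averages.convInv_companion_rev hΘ, hΘ_spitzer, hRt]
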